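/- **Setting.** Let $N\ge 1$, $\omega\in\mathbb C$ with $\Im\omega>0$, $\Gamma=\pi\mathbb Z+\pi\omega\mathbb Z$, and $\theta(z)=-i\sum_{k\in\mathbb Z}(-1)^k e^{i\pi\omega(k+\frac12)^2}e^{2i(k+\frac12)z}$. Let $x,y\in\{0,1\}$, $\eta\in\mathbb C$, $t_0=-\frac{\eta}{2}N+x\frac{\pi}{2}+y\frac{\pi}{2}\omega$ and $t(a)=-\eta a+t_0$ for $a\in\mathbb Z$. Assume that $\eta\notin\Gamma$ and $t(a)\notin\Gamma$ for all $a\in\mathbb Z$ (this holds for generic $\eta$, with $(x,y)\ne(0,0)$ when $N$ is even, a condition which it forces). Let $\xi_1,\dots,\xi_N\in\mathbb C$ satisfy $\xi_a-\xi_b+\epsilon\eta\notin\Gamma$ for all $a\neq b$ and $\epsilon\in\{-1,0,1\}$. Put $a(\lambda)=\theta(\lambda+\eta)$, $b(\lambda|t)=\frac{\theta(\lambda)\theta(t+\eta)}{\theta(t)}$, $c(\lambda|t)=\frac{\theta(\eta)\theta(t+\lambda)}{\theta(t)}$ and $$R(\lambda|t)=\begin{pmatrix}a(\lambda)&0&0&0\\0&e^{iy\eta}b(\lambda|t)&e^{iy\lambda}c(\lambda|t)&0\\0&e^{-iy\lambda}c(\lambda|-t)&e^{-iy\eta}b(\lambda|-t)&0\\0&0&0&a(\lambda)\end{pmatrix}.$$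 Let $V_n=\mathbb C^2$ with basis $|n,h\rangle$, $h\in\{0,1\}$, $\sigma^z_n|n,h\rangle=(1-2h)|n,h\rangle$. Let $\mathbb D$ have basis $|t(a)\rangle$, $a\in\mathbb Z$, with $\tau|t(a)\rangle=t(a)|t(a)\rangle$ and $T_\tau^{\pm}|t(a)\rangle=|t(a\pm1)\rangle$. Use the dual basis of covectors on $(\otimes_{n=1}^N V_n)\otimes\mathbb D$; operators act on covectors from the right. Let $\mathsf M_0(\lambda|t)=R_{0,N}(\lambda-\xi_N|t+\eta\sum_{a<N}\sigma_a^z)\cdots R_{0,1}(\lambda-\xi_1|t)$, let $\mathsf C(\lambda|t)$ be its lower left entry in $V_0$, and $\mathcal C(\lambda)=\mathsf C(\lambda|\tau)\,T_\tau^{+}$. Put $\mathsf d(\lambda)=\prod_{n=1}^N\theta(\lambda-\xi_n)$. For $r\in\mathbb Z$ and $\mathbf h\in\{0,1\}^N$ let $t_{r,\mathbf h}=-\frac{\eta}{2}\sum_{k}(1-2h_k)+x\frac{\pi}{2}+y\frac{\pi}{2}\omega+r\eta$, which equals $t(-r-\sum_k h_k)$, and write $|t_{r,\mathbf h}\rangle$,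 $\langle t_{r,\mathbf h}|$ for the corresponding basis vector and covector. With $\mathbf 0=(0,\dots,0)$, $\mathbf 1=(1,\dots,1)$ and a constant $\mathsf n\neq0$, set $\langle r,\mathbf 0|=\frac1{\mathsf n}(\otimes_n\langle n,0|)\otimes\langle t_{r,\mathbf 0}|$, $|\mathbf 1,r\rangle=\frac1{\mathsf n}(\otimes_n|n,1\rangle)\otimes|t_{r,\mathbf 1}\rangle$ and $$\langle r,\mathbf h|=\langle r,\mathbf 0|\prod_{n=1}^N\Big(\frac{\mathcal C(\xi_n)}{\mathsf d(\xi_n-\eta)}\Big)^{h_n},\qquad |\mathbf h,r\rangle=\prod_{n=1}^N\Big(\frac{\mathcal C(\xi_n-\eta)}{\mathsf d(\xi_n-\eta)}\Big)^{1-h_n}|\mathbf 1,r\rangle .$$ For $0\le j\le N-1$ put $\vartheta_j(\lambda)=\sum_{n\in\mathbb Z}e^{i\pi N\omega(n+\frac12-\frac jN)^2+2iN(n+\frac12-\frac jN)(\lambda-\frac\pi2)}$, and let $\Theta^{(r,\mathbf h)}$ be the $N\times N$ matrix with entries $\vartheta_{j-1}(\xi_i^{(h_i)}-\bar\xi_r)$,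 $1\le i,j\le N$, where $\xi_i^{(h_i)}=\xi_i-\eta h_i$ and $\bar\xi_r=\frac1N\big(\sum_k\xi_k+t_{r,\mathbf 0}\big)$. **Proposition.** 1. The functions $\vartheta_0,\dots,\vartheta_{N-1}$ form a basis of the space of theta functions of order $N$ and norm $0$, i.e. of entire functions $f$ with $f(z+\pi)=(-1)^Nf(z)$ and $f(z+\pi\omega)=(-1)^Ne^{-iN(2z+\pi\omega)}f(z)$. 2. $\theta(t_{0,\mathbf 1})\ne0$, and $\det_N[\Theta^{(r,\mathbf h)}]\neq0$ for all $r\in\mathbb Z$ and $\mathbf h\in\{0,1\}^N$. 3. One can choose the normalization constant $\mathsf n\neq0$, independent of $r$ and $\mathbf h$, such that for all $r,\tilde r\in\mathbb Z$ and $\mathbf h,\tilde{\mathbf h}\in\{0,1\}^N$ $$\langle r,\mathbf h|\tilde{\mathbf h},\tilde r\rangle=\delta_{r,\tilde r}\,\delta_{\mathbf h,\tilde{\mathbf h}}\,\frac{\theta(t_{r,\mathbf 1})}{\theta(t_{0,\mathbf 1})}\,\frac{e^{-iy\eta\sum_{k=1}^Nh_k}}{\det_N\big[\Theta^{(r,\mathbf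 h)}\big]}.$$ -/

import Mathlib

open Complex
open scoped Real

noncomputable section

namespace SOS

/-! ### Theta functions -/

/-- The theta function `θ(z) = θ₁(z | ω)` with quasi-periods `π` and `πω`. -/
def theta (ω z : ℂ) : ℂ :=
  -I * ∑' k : ℤ, (-1 : ℂ) ^ k * exp (I * π * ω * ((k : ℂ) + 1 / 2) ^ 2)
    * exp (2 * I * ((k : ℂ) + 1 / 2) * z)

/-- The lattice `Γ = πℤ + πωℤ`. -/
def periodLattice (ω : ℂ) : Set ℂ :=
  {z | ∃ m n : ℤ, z = m * π + n * (π * ω)}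

/-- `f` is a theta function of quasi-periods `(π, πω)`, of order `n` and norm `α`. -/
def IsThetaFunction (ω : ℂ) (n : ℕ) (α : ℂ) (f : ℂ → ℂ) : Prop :=
  Differentiable ℂ f ∧
  (∀ z, f (z + π) = (-1) ^ n * f z) ∧
  (∀ z, f (z + π * ω) =
    (-1) ^ n * exp (2 * I * α) * exp (-I * n * (2 * z + π * ω)) * f z)

/-- The functions `ϑ_j`, `0 ≤ j ≤ N - 1`. -/
def vartheta (N : ℕ) (ω : ℂ) (j : ℕ) (z : ℂ) : ℂ :=
  ∑' n : ℤ, exp (I * π * N * ω * ((n : ℂ) + 1 / 2 - j / N) ^ 2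
    + 2 * I * N * ((n : ℂ) + 1 / 2 - j / N) * (z - π / 2))

/-! ### The model -/

/-- The parameters of the dynamical 6-vertex model with `N` sites: the modulus `ω`, the crossing
parameter `η`, the integers `x, y` and the inhomogeneities `ξ 0, …, ξ (N - 1)`. -/
structure Params (N : ℕ) where
  ω : ℂ
  η : ℂ
  x : ℕ
  y : ℕ
  ξ : Fin N → ℂ

/-- Spin configurations `(h_1, …, h_N) ∈ {0,1}^N`; `h_n = 0` is spin up, `h_n = 1` spin down. -/
abbrev Spins (N : ℕ) : Type := Fin N → Fin 2

/-- The eigenvalue `1 - 2h` of `σ^z` on the basis vector with label `h`. -/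
def sz (h : Fin 2) : ℂ := 1 - 2 * ((h : ℕ) : ℂ)

/-- The space `𝕍_N ⊗ 𝔻`, realized through its dynamical-spin basis: the basis vector with
label `(h, a)` is `(⊗_n |n, h_n⟩) ⊗ |t(a)⟩`. -/
abbrev Ket (N : ℕ) : Type := (Spins N × ℤ) →₀ ℂ

/-- Covectors. An operator `O` acts on them to the left by `⟨φ| O = φ ∘ O`, and the pairing
of `⟨φ|` with `|v⟩` is `φ v`. -/
abbrev Bra (N : ℕ) : Type := Ket N →ₗ[ℂ] ℂ

/-- The basis vector `(⊗_n |n, h_n⟩) ⊗ |t(a)⟩`. -/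
def basisKet {N : ℕ} (h : Spins N) (a : ℤ) : Ket N := Finsupp.single (h, a) 1

/-- The dual basis covector `(⊗_n ⟨n, h_n|) ⊗ ⟨t(a)|`. -/
def basisBra {N : ℕ} (h : Spins N) (a : ℤ) : Bra N := Finsupp.lapply (h, a)

namespace Params

variable {N : ℕ} (p : Params N)

def wa (l : ℂ) : ℂ := theta p.ω (l + p.η)

def wb (l t : ℂ) : ℂ := theta p.ω l * theta p.ω (t + p.η) / theta p.ω t

def wc (l t : ℂ) : ℂ := theta p.ω p.η * theta p.ω (t + l) / theta p.ω t

/-- The dynamical `R`-matrix `R(l | t)` on `ℂ² ⊗ ℂ²`, in the basis `++, +-, -+, --`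
(labels `00, 01, 10, 11`); the first argument is the row. -/
def R (l t : ℂ) : Matrix (Fin 2 × Fin 2) (Fin 2 × Fin 2) ℂ := fun i j =>
  match i, j with
  | (0, 0), (0, 0) => p.wa l
  | (0, 1), (0, 1) => exp (I * p.y * p.η) * p.wb l t
  | (0, 1), (1, 0) => exp (I * p.y * l) * p.wc l t
  | (1, 0), (0, 1) => exp (-I * p.y * l) * p.wc l (-t)
  | (1, 0), (1, 0) => exp (-I * p.y * p.η) * p.wb l (-t)
  | (1, 1), (1, 1) => p.wa l
  | _, _ => 0

/-- The operator `R_{0,n}(l - ξ_n | t + η ∑_{a<n} σ_a^z)` on `V_0 ⊗ V_1 ⊗ … ⊗ V_N`; an index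
is a pair (label in the auxiliary space `V_0`, spin configuration). -/
def site (l t : ℂ) (n : Fin N) : Matrix (Fin 2 × Spins N) (Fin 2 × Spins N) ℂ := fun i j =>
  if ∀ m, m ≠ n → i.2 m = j.2 m then
    p.R (l - p.ξ n) (t + p.η * ∑ a ∈ Finset.univ.filter (· < n), sz (j.2 a))
      (i.1, i.2 n) (j.1, j.2 n)
  else 0

/-- The monodromy matrix
`M_0(l | t) = R_{0,N}(l - ξ_N | t + η ∑_{a<N} σ_a^z) ⋯ R_{0,1}(l - ξ_1 | t)`. -/
def monodromy (l t : ℂ) : Matrix (Fin 2 × Spins N) (Fin 2 × Spins N) ℂ :=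
  (List.ofFn fun n => p.site l t n).reverse.prod

/-- `t_0 = -(η/2) N + x π/2 + y (π/2) ω`. -/
def t0 : ℂ := -(p.η / 2) * N + p.x * (π / 2) + p.y * (π / 2 * p.ω)

/-- `t(a) = -η a + t_0`, the eigenvalue of `τ` on `|t(a)⟩`. -/
def t (a : ℤ) : ℂ := -p.η * a + p.t0

/-- The entry `(i, j)` of `M_0(l | τ)`, an operator on `𝕍_N ⊗ 𝔻`: on `|h⟩ ⊗ |t(a)⟩`, the
operator `τ` takes the value `t(a)`. -/
def monodromyTau (i j : Fin 2) (l : ℂ) : Module.End ℂ (Ket N) :=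
  Finsupp.linearCombination ℂ fun s : Spins N × ℤ =>
    ∑ h : Spins N, p.monodromy l (p.t s.2) (i, h) (j, s.1) • basisKet h s.2

end Params

/-- The operator `T_τ^k`: `|h⟩ ⊗ |t(a)⟩ ↦ |h⟩ ⊗ |t(a + k)⟩`. -/
def shift {N : ℕ} (k : ℤ) : Module.End ℂ (Ket N) :=
  Finsupp.lmapDomain ℂ ℂ fun s : Spins N × ℤ => (s.1, s.2 + k)

namespace Params

variable {N : ℕ} (p : Params N)

/-- The entry `(i, j)` of `𝓜_0(l) = M_0(l | τ) T_τ^{σ_0^z}`. The entries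
`(0,0), (0,1), (1,0), (1,1)` are `𝓐, 𝓑, 𝓒, 𝓓`. -/
def calM (i j : Fin 2) (l : ℂ) : Module.End ℂ (Ket N) :=
  p.monodromyTau i j l * shift (if j = 0 then 1 else -1)

/-- The operator `𝓒(l)`. -/
def calC (l : ℂ) : Module.End ℂ (Ket N) := p.calM 1 0 l

/-- `𝖺(l) = ∏_n a(l - ξ_n)`. -/
def funA (l : ℂ) : ℂ := ∏ n, p.wa (l - p.ξ n)

/-- `𝖽(l) = 𝖺(l - η)`. -/
def funD (l : ℂ) : ℂ := p.funA (l - p.η)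

/-- `t_{r,h} = -(η/2) s_h + x π/2 + y (π/2) ω + r η`, with `s_h = ∑_k (1 - 2 h_k)`. -/
def trh (r : ℤ) (h : Spins N) : ℂ :=
  -(p.η / 2) * ∑ k, sz (h k) + p.x * (π / 2) + p.y * (π / 2 * p.ω) + r * p.η

end Params

/-- The label `a` with `|t_{r,h}⟩ = |t(a)⟩` and `⟨t_{r,h}| = ⟨t(a)|`. -/
def dynLabel {N : ℕ} (r : ℤ) (h : Spins N) : ℤ := -r - ∑ k, ((h k : ℕ) : ℤ)

theorem Params.t_dynLabel {N : ℕ} (p : Params N) (r : ℤ) (h : Spins N) :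
    p.t (dynLabel r h) = p.trh r h := by
  simp only [Params.t, dynLabel, Params.trh, Params.t0, sz, Finset.sum_sub_distrib,
    ← Finset.mul_sum]
  push_cast
  simp
  ring

namespace Params

variable {N : ℕ} (p : Params N)

/-- The left reference state `⟨r, 0|`, with normalization constant `c`. -/
def refBra (c : ℂ) (r : ℤ) : Bra N := c⁻¹ • basisBra 0 (dynLabel r (0 : Spins N))

/-- The right reference state `|1, r⟩`, with normalization constant `c`. -/
def refKet (c : ℂ) (r : ℤ) : Ket N := c⁻¹ • basisKet 1 (dynLabel r (1 : Spins N))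

/-- The left SOV state `⟨r, h| = ⟨r, 0| ∏_{n=1}^N (𝓒(ξ_n) / 𝖽(ξ_n - η))^{h_n}`. -/
def sovBra (c : ℂ) (r : ℤ) (h : Spins N) : Bra N :=
  (refBra c r).comp
    (List.ofFn fun n =>
      ((p.funD (p.ξ n - p.η))⁻¹ • p.calC (p.ξ n)) ^ (h n : ℕ)).prod

/-- The right SOV state `|h, r⟩ = ∏_{n=1}^N (𝓒(ξ_n - η) / 𝖽(ξ_n - η))^{1 - h_n} |1, r⟩`. -/
def sovKet (c : ℂ) (r : ℤ) (h : Spins N) : Ket N :=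
  (List.ofFn fun n =>
    ((p.funD (p.ξ n - p.η))⁻¹ • p.calC (p.ξ n - p.η)) ^ (1 - (h n : ℕ))).prod
    (refKet c r)

/-- `ξ_i^{(h_i)} = ξ_i - η h_i`. -/
def xiShift (h : Spins N) (i : Fin N) : ℂ := p.ξ i - p.η * ((h i : ℕ) : ℂ)

/-- `ξ̄_r = (∑_k ξ_k + t_{r,0}) / N`. -/
def xiBar (r : ℤ) : ℂ := (∑ k, p.ξ k + p.trh r 0) / N

/-- The matrix `Θ^{(r,h)}` with entries `ϑ_{j-1}(ξ_i^{(h_i)} - ξ̄_r)`, `1 ≤ i, j ≤ N`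
(the indices of `Fin N` start at `0`). -/
def Theta (r : ℤ) (h : Spins N) : Matrix (Fin N) (Fin N) ℂ :=
  Matrix.of fun i j => vartheta N p.ω j (p.xiShift h i - p.xiBar r)

end Params

end SOS

end

/-! The phases of the `R`-matrix are ratios of exponentials in the dynamical parameter. They
disappear once `θ(s)` is replaced by `e^{κs} θ(s)`, `κ = iy`, wherever that parameter occurs
(`R_eq_dynR`). The dynamical Yang–Baxter equation (`dynYBE`) then follows from the Weierstrass
three-term identity. Pulling `R` through two stacked rows gives two facts. The operators `𝓒` commute
(`rowPair_comm`), and `𝓒(ξ_n) 𝓒(ξ_n - η) = 0` (`rowPair_fusion`), because `R(0)` is proportional to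
the permutation and `θ(0) = 0`.

A pairing `⟨r, h | h', r'⟩` is a matrix element of a product of `𝓒`'s between the all-up covector
and the all-down vector. Each `𝓒` flips one spin down to up, so exactly `N` factors are needed. If
`h ≠ h'` with the right number of factors, some site contributes both `ξ_n` and `ξ_n - η`, and the
product vanishes. If `h = h'`, each site contributes one factor. Moved to one end of the product,
the factor of the first site is forced to flip the first spin; that spin freezes and induction on
`N` gives a product formula (`chain_sov_self`).

On the analytic side, Fourier coefficients bound the dimension of the theta functions of order `N`
by `N`, and the `ϑ_j` are eigenvectors of the shift by `π/N` with distinct eigenvalues; hence they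
form a basis. The case `N = 2` yields an addition formula, which gives both the three-term identity
and the location of the zeros of `θ`. Elliptic Lagrange interpolation shows that `det ϑ_j(z_i)` is a
nonzero constant times `θ(∑ z_i) ∏_{i<j} θ(z_i - z_j)`, wherever this product is nonzero
(`thetaDet_mul_thetaVandermonde`). At the points of `Θ^{(r,h)}` this product carries the whole
`h`-dependence of the product formula except the phase, so one constant normalizes all pairings. -/

open Complex
open scoped Real

noncomputable section

namespace SOS

/-! ### The twisted `R`-matrix and the three-term identity -/

/-- `θ` twisted by the exponential `e^{κs}`. -/
def twist (θ : ℂ → ℂ) (κ s : ℂ) : ℂ := exp (κ * s) * θ s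

/-- The dynamical `R`-matrix written with the twisted function `e^{κs} θ(s)`. -/
def dynR (θ : ℂ → ℂ) (κ η l t : ℂ) (i j : Fin 2 × Fin 2) : ℂ :=
  match i, j with
  | (0, 0), (0, 0) => θ (l + η)
  | (0, 1), (0, 1) => θ l * twist θ κ (t + η) / twist θ κ t
  | (0, 1), (1, 0) => θ η * twist θ κ (t + l) / twist θ κ t
  | (1, 0), (0, 1) => θ η * twist θ κ (t - l) / twist θ κ t
  | (1, 0), (1, 0) => θ l * twist θ κ (t - η) / twist θ κ t
  | (1, 1), (1, 1) => θ (l + η)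
  | _, _ => 0

/-- `θ` is odd and satisfies the three-term identity of Weierstrass. -/
structure ThreeTerm (θ : ℂ → ℂ) : Prop where
  odd : ∀ z, θ (-z) = -θ z
  rel : ∀ x y u v, θ (x + y) * θ (x - y) * θ (u + v) * θ (u - v)
    - θ (x + u) * θ (x - u) * θ (y + v) * θ (y - v)
    + θ (x + v) * θ (x - v) * θ (y + u) * θ (y - u) = 0

namespace ThreeTerm

variable {θ : ℂ → ℂ} (hθ : ThreeTerm θ)
include hθ

theorem zero : θ 0 = 0 := by
  have := hθ.odd 0
  simp only [neg_zero] at this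
  linear_combination this / 2

/-- In each term the two twisted arguments add up to `2x`, so all three terms carry the same
exponential. -/
theorem twist_rel (κ x y u v : ℂ) :
    twist θ κ (x + y) * twist θ κ (x - y) * θ (u + v) * θ (u - v)
    - twist θ κ (x + u) * twist θ κ (x - u) * θ (y + v) * θ (y - v)
    + twist θ κ (x + v) * twist θ κ (x - v) * θ (y + u) * θ (y - u) = 0 := by
  have e : ∀ a, exp (κ * (x + a)) * exp (κ * (x - a)) = exp (2 * κ * x) := fun a => by
    rw [← exp_add]; ring_nf
  unfold twist
  linear_combination exp (2 * κ * x) * hθ.rel x y u v + e y * θ (x + y) * θ (x - y) * θ (u + v) * θ (u - v)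
    - e u * θ (x + u) * θ (x - u) * θ (y + v) * θ (y - v)
    + e v * θ (x + v) * θ (x - v) * θ (y + u) * θ (y - u)

/-- The form used on Yang–Baxter components: the three twisted pairs share their sum `2x`, and `y`,
`u`, `v` are their half-differences. -/
theorem twist_rel' (κ : ℂ) {p q r s p' q' r' s' p'' q'' r'' s'' : ℂ}
    (h' : p' + q' = p + q) (h'' : p'' + q'' = p + q)
    (hr : r = (p' - q') / 2 + (p'' - q'') / 2) (hs : s = (p' - q') / 2 - (p'' - q'') / 2)
    (hr' : r' = (p - q) / 2 + (p'' - q'') / 2) (hs' : s' = (p - q) / 2 - (p'' - q'') / 2)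
    (hr'' : r'' = (p - q) / 2 + (p' - q') / 2) (hs'' : s'' = (p' - q') / 2 - (p - q) / 2) :
    twist θ κ p * twist θ κ q * θ r * θ s = twist θ κ p' * twist θ κ q' * θ r' * θ s'
      + twist θ κ p'' * twist θ κ q'' * θ r'' * θ s'' := by
  have w := hθ.twist_rel κ ((p + q) / 2) ((p - q) / 2) ((p' - q') / 2) ((p'' - q'') / 2)
  rw [← hr, ← hs, ← hr', ← hs', ← hr'', show (p - q) / 2 - (p' - q') / 2 = -s'' by rw [hs'']; ring,
    hθ.odd, show (p + q) / 2 + (p - q) / 2 = p by ring, show (p + q) / 2 - (p - q) / 2 = q by ring,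
    show (p + q) / 2 + (p' - q') / 2 = p' by rw [← h']; ring,
    show (p + q) / 2 - (p' - q') / 2 = q' by rw [← h']; ring,
    show (p + q) / 2 + (p'' - q'') / 2 = p'' by rw [← h'']; ring,
    show (p + q) / 2 - (p'' - q'') / 2 = q'' by rw [← h'']; ring] at w
  linear_combination w

theorem twist_cube (κ η u : ℂ) :
    twist θ κ u ^ 3 * twist θ κ (u + 2 * η) - twist θ κ (u - η) * twist θ κ (u + η) ^ 3
      = exp (κ * (4 * u + 2 * η)) * θ (2 * u + η) * θ η ^ 3 := by
  have e1 : exp (κ * u) ^ 3 * exp (κ * (u + 2 * η)) = exp (κ * (4 * u + 2 * η)) := by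
    rw [← exp_nat_mul, ← exp_add]; push_cast; ring_nf
  have e2 : exp (κ * (u - η)) * exp (κ * (u + η)) ^ 3 = exp (κ * (4 * u + 2 * η)) := by
    rw [← exp_nat_mul, ← exp_add]; push_cast; ring_nf
  have r : θ u ^ 3 * θ (u + 2 * η) - θ (u - η) * θ (u + η) ^ 3 = θ (2 * u + η) * θ η ^ 3 := by
    have w := hθ.rel (u + η) η u 0
    rw [show u + η + η = u + 2 * η by ring, show u + η - η = u by ring,
      show u + η + u = 2 * u + η by ring, show u + η - u = η by ring,
      show η - u = -(u - η) by ring, hθ.odd, show η + u = u + η by ring] at w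
    simp only [add_zero, sub_zero] at w
    linear_combination w
  unfold twist
  linear_combination exp (κ * (4 * u + 2 * η)) * r + e1 * θ u ^ 3 * θ (u + 2 * η) - e2 * θ (u - η) * θ (u + η) ^ 3

/-- The right side shares the factor `exp (κ * (4u + 2η)) * θ (2u + η)` with `twist_cube`, so that
the two identities cancel in `dynYBE_010_010`. -/
theorem twist_quad (κ η u x m : ℂ) :
    twist θ κ u * twist θ κ (u - x) * twist θ κ (u + η + m) * twist θ κ (u + η + (x - m))
      - twist θ κ (u + η) * twist θ κ (u - (x - m)) * twist θ κ (u - m) * twist θ κ (u + η + x)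
      = - exp (κ * (4 * u + 2 * η)) * θ (2 * u + η) * θ m * θ (x - m) * θ (x + η) := by
  have e1 : exp (κ * u) * exp (κ * (u - x)) * exp (κ * (u + η + m)) * exp (κ * (u + η + (x - m)))
      = exp (κ * (4 * u + 2 * η)) := by
    simp only [← exp_add]; ring_nf
  have e2 : exp (κ * (u + η)) * exp (κ * (u - (x - m))) * exp (κ * (u - m)) * exp (κ * (u + η + x))
      = exp (κ * (4 * u + 2 * η)) := by
    simp only [← exp_add]; ring_nf
  have r : θ u * θ (u - x) * θ (u + η + m) * θ (u + η + (x - m))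
      - θ (u + η) * θ (u - (x - m)) * θ (u - m) * θ (u + η + x)
      = - θ (2 * u + η) * θ m * θ (x - m) * θ (x + η) := by
    have w := hθ.rel (u - x / 2) (x / 2) (u + η + x / 2) (m - x / 2)
    rw [show u - x / 2 + x / 2 = u by ring, show u - x / 2 - x / 2 = u - x by ring,
      show u + η + x / 2 + (m - x / 2) = u + η + m by ring,
      show u + η + x / 2 - (m - x / 2) = u + η + (x - m) by ring,
      show u - x / 2 + (u + η + x / 2) = 2 * u + η by ring,
      show u - x / 2 - (u + η + x / 2) = -(x + η) by ring, hθ.odd (x + η),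
      show x / 2 + (m - x / 2) = m by ring, show x / 2 - (m - x / 2) = x - m by ring,
      show u - x / 2 + (m - x / 2) = u - (x - m) by ring,
      show u - x / 2 - (m - x / 2) = u - m by ring,
      show x / 2 + (u + η + x / 2) = u + η + x by ring,
      show x / 2 - (u + η + x / 2) = -(u + η) by ring, hθ.odd (u + η)] at w
    linear_combination w
  unfold twist
  linear_combination exp (κ * (4 * u + 2 * η)) * r
    + e1 * θ u * θ (u - x) * θ (u + η + m) * θ (u + η + (x - m))
    - e2 * θ (u + η) * θ (u - (x - m)) * θ (u - m) * θ (u + η + x)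

end ThreeTerm

/-! ### The dynamical Yang–Baxter equation -/

/-- The product of two `R`-matrices acting on the same quantum space, with spectral parameters
`x` (left factor) and `m` (right factor). -/
def doubleSite (θ : ℂ → ℂ) (κ η x m u : ℂ) (i₁ i₂ h' j₁ j₂ h : Fin 2) : ℂ :=
  ∑ k, dynR θ κ η x u (i₁, h') (j₁, k) * dynR θ κ η m (u + η * sz j₁) (i₂, k) (j₂, h)

theorem sz_zero : sz 0 = 1 := by simp [sz]
theorem sz_one : sz 1 = -1 := by simp [sz]; norm_num

/-- The dynamical Yang–Baxter equation. -/
def DynYBE (θ : ℂ → ℂ) (κ η x m u : ℂ) (i₁ i₂ h' j₁ j₂ h : Fin 2) : Prop :=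
  ∑ a, ∑ b, dynR θ κ η (x - m) (u + η * sz h') (i₁, i₂) (a, b) *
      doubleSite θ κ η x m u a b h' j₁ j₂ h
    = ∑ a, ∑ b, doubleSite θ κ η m x u i₂ i₁ h' b a h * dynR θ κ η (x - m) u (a, b) (j₁, j₂)

/-- Spin reversal amounts to `t ↦ -t`, `κ ↦ -κ`: oddness of `θ` produces signs that cancel in the
ratios. -/
theorem dynR_flip {θ : ℂ → ℂ} (hθ : ThreeTerm θ) (κ η l t : ℂ) (a b c d : Fin 2) :
    dynR θ κ η l t (a, b) (c, d) = dynR θ (-κ) η l (-t) (1 - a, 1 - b) (1 - c, 1 - d) := by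
  have e : ∀ s, twist θ κ s = - twist θ (-κ) (-s) := fun s => by
    simp [twist, hθ.odd]
  fin_cases a <;> fin_cases b <;> fin_cases c <;> fin_cases d <;> simp [dynR, e] <;> ring_nf

theorem dynYBE_flip {θ : ℂ → ℂ} (hθ : ThreeTerm θ) {κ η x m u : ℂ} {i₁ i₂ h' j₁ j₂ h : Fin 2}
    (H : DynYBE θ (-κ) η x m (-u) (1 - i₁) (1 - i₂) (1 - h') (1 - j₁) (1 - j₂) (1 - h)) :
    DynYBE θ κ η x m u i₁ i₂ h' j₁ j₂ h := by
  have s : ∀ f : Fin 2 → ℂ, ∑ a, f (1 - a) = ∑ a, f a := fun f => by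
    simp [Fin.sum_univ_two, add_comm]
  have z : ∀ a : Fin 2, sz (1 - a) = - sz a := fun a => by
    fin_cases a <;> simp [sz_zero, sz_one]
  have hD : ∀ x m i₁ i₂ h' j₁ j₂ h, doubleSite θ κ η x m u i₁ i₂ h' j₁ j₂ h
      = doubleSite θ (-κ) η x m (-u) (1 - i₁) (1 - i₂) (1 - h') (1 - j₁) (1 - j₂) (1 - h) := by
    intro x m i₁ i₂ h' j₁ j₂ h
    unfold doubleSite
    rw [← s]
    refine Finset.sum_congr rfl fun k _ => ?_
    rw [dynR_flip hθ, dynR_flip hθ κ η m, sub_sub_cancel, z]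
    congr 2
    ring
  have hs : ∀ h : Fin 2, -(u + η * sz h) = -u + η * sz (1 - h) := fun h => by rw [z]; ring
  unfold DynYBE at H ⊢
  simp_rw [hD, dynR_flip hθ κ η (x - m), hs]
  simp only [Fin.sum_univ_two, sub_zero, sub_self] at H ⊢
  linear_combination H

/-- The ice rule: `R` conserves the number of down spins. -/
theorem dynR_ice (θ : ℂ → ℂ) (κ η l t : ℂ) (a b c d : Fin 2)
    (h : (a : ℕ) + b ≠ c + d) : dynR θ κ η l t (a, b) (c, d) = 0 := by
  fin_cases a <;> fin_cases b <;> fin_cases c <;> fin_cases d <;> first | rfl | simp at h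

theorem doubleSite_ice (θ : ℂ → ℂ) (κ η x m u : ℂ) (i₁ i₂ h' j₁ j₂ h : Fin 2)
    (hs : (i₁ : ℕ) + i₂ + h' ≠ j₁ + j₂ + h) : doubleSite θ κ η x m u i₁ i₂ h' j₁ j₂ h = 0 := by
  refine Finset.sum_eq_zero fun k _ => ?_
  by_cases h1 : (i₁ : ℕ) + h' = j₁ + k
  · rw [dynR_ice θ κ η m _ i₂ k j₂ h (by omega), mul_zero]
  · rw [dynR_ice θ κ η x _ i₁ h' j₁ k h1, zero_mul]

theorem dynYBE_ice (θ : ℂ → ℂ) (κ η x m u : ℂ) (i₁ i₂ h' j₁ j₂ h : Fin 2)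
    (hs : (i₁ : ℕ) + i₂ + h' ≠ j₁ + j₂ + h) : DynYBE θ κ η x m u i₁ i₂ h' j₁ j₂ h := by
  unfold DynYBE
  rw [Finset.sum_eq_zero, Finset.sum_eq_zero]
  · refine fun a _ => Finset.sum_eq_zero fun b _ => ?_
    by_cases h1 : (a : ℕ) + b = j₁ + j₂
    · rw [doubleSite_ice _ _ _ _ _ _ _ _ _ _ _ _ (by omega), zero_mul]
    · rw [dynR_ice _ _ _ _ _ _ _ _ _ h1, mul_zero]
  · refine fun a _ => Finset.sum_eq_zero fun b _ => ?_
    by_cases h1 : (i₁ : ℕ) + i₂ = a + b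
    · rw [doubleSite_ice _ _ _ _ _ _ _ _ _ _ _ _ (by omega), mul_zero]
    · rw [dynR_ice _ _ _ _ _ _ _ _ _ h1, zero_mul]

theorem dynYBE_001_001 (θ : ℂ → ℂ) (κ η x m u : ℂ) : DynYBE θ κ η x m u 0 0 1 0 0 1 := by
  simp [DynYBE, doubleSite, Fin.sum_univ_two, dynR, sz_zero, sz_one]
  ring

theorem dynYBE_100_100 {θ : ℂ → ℂ} {κ η x m u : ℂ} (h0 : θ u ≠ 0) (hp : θ (u + η) ≠ 0) : DynYBE θ κ η x m u 1 0 0 1 0 0 := by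
  have g0 : twist θ κ u ≠ 0 := mul_ne_zero (exp_ne_zero _) h0
  have gp : twist θ κ (u + η) ≠ 0 := mul_ne_zero (exp_ne_zero _) hp
  simp [DynYBE, doubleSite, Fin.sum_univ_two, dynR, sz_zero, sz_one]
  field_simp

section OneDown

variable {θ : ℂ → ℂ} (hθ : ThreeTerm θ) {κ η x m u : ℂ} (h0 : θ u ≠ 0) (hp : θ (u + η) ≠ 0)
include hθ h0 hp

theorem dynYBE_001_010 : DynYBE θ κ η x m u 0 0 1 0 1 0 := by
  have g0 : twist θ κ u ≠ 0 := mul_ne_zero (exp_ne_zero _) h0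
  have gp : twist θ κ (u + η) ≠ 0 := mul_ne_zero (exp_ne_zero _) hp
  simp [DynYBE, doubleSite, Fin.sum_univ_two, dynR, sz_zero, sz_one]
  field_simp
  have w := hθ.twist_rel' κ (p := u + η + m) (q := u) (p' := u + η + x) (q' := u - (x - m))
    (p'' := u + η) (q'' := u + m) (r := x - m + η) (s := x) (r' := η) (s' := m)
    (r'' := x + η) (s'' := x - m)
    (by ring) (by ring) (by ring) (by ring) (by ring) (by ring) (by ring) (by ring)
  linear_combination θ η * w

theorem dynYBE_001_100 : DynYBE θ κ η x m u 0 0 1 1 0 0 := by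
  have g0 : twist θ κ u ≠ 0 := mul_ne_zero (exp_ne_zero _) h0
  have gp : twist θ κ (u + η) ≠ 0 := mul_ne_zero (exp_ne_zero _) hp
  simp [DynYBE, doubleSite, Fin.sum_univ_two, dynR, sz_zero, sz_one]
  field_simp
  have w := hθ.twist_rel' κ (p := u + x) (q := u) (p' := u + η + x) (q' := u - η)
    (p'' := u + m) (q'' := u + (x - m)) (r := m + η) (s := x - m + η) (r' := m) (s' := x - m)
    (r'' := x + η) (s'' := η)
    (by ring) (by ring) (by ring) (by ring) (by ring) (by ring) (by ring) (by ring)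
  linear_combination θ η * w

theorem dynYBE_010_001 : DynYBE θ κ η x m u 0 1 0 0 0 1 := by
  have g0 : twist θ κ u ≠ 0 := mul_ne_zero (exp_ne_zero _) h0
  have gp : twist θ κ (u + η) ≠ 0 := mul_ne_zero (exp_ne_zero _) hp
  simp [DynYBE, doubleSite, Fin.sum_univ_two, dynR, sz_zero, sz_one]
  field_simp
  have w := hθ.twist_rel' κ (p := u + η) (q := u - m) (p' := u + η + (x - m)) (q' := u - x)
    (p'' := u + η - m) (q'' := u) (r := x - m + η) (s := x) (r' := η) (s' := m)
    (r'' := x + η) (s'' := x - m)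
    (by ring) (by ring) (by ring) (by ring) (by ring) (by ring) (by ring) (by ring)
  linear_combination (-(twist θ κ (u + η + η) * θ η)) * w

/-- The one component that a single three-term relation does not settle. It splits into `twist_cube`
and `twist_quad`, weighted so that their right sides cancel. -/
theorem dynYBE_010_010 : DynYBE θ κ η x m u 0 1 0 0 1 0 := by
  have g0 : twist θ κ u ≠ 0 := mul_ne_zero (exp_ne_zero _) h0
  have gp : twist θ κ (u + η) ≠ 0 := mul_ne_zero (exp_ne_zero _) hp
  simp [DynYBE, doubleSite, Fin.sum_univ_two, dynR, sz_zero, sz_one]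
  field_simp
  have w := hθ.twist_cube κ η u
  rw [show u + 2 * η = u + η + η by ring] at w
  linear_combination θ (x - m) * θ (x + η) * θ m * w + θ η ^ 3 * hθ.twist_quad κ η u x m

theorem dynYBE_010_100 : DynYBE θ κ η x m u 0 1 0 1 0 0 := by
  have g0 : twist θ κ u ≠ 0 := mul_ne_zero (exp_ne_zero _) h0
  have gp : twist θ κ (u + η) ≠ 0 := mul_ne_zero (exp_ne_zero _) hp
  simp [DynYBE, doubleSite, Fin.sum_univ_two, dynR, sz_zero, sz_one]
  field_simp
  have w := hθ.twist_rel' κ (p := u + η + (x - m)) (q := u) (p' := u + η + x) (q' := u - m)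
    (p'' := u + η) (q'' := u + (x - m)) (r := m + η) (s := x) (r' := η) (s' := x - m)
    (r'' := x + η) (s'' := m)
    (by ring) (by ring) (by ring) (by ring) (by ring) (by ring) (by ring) (by ring)
  linear_combination θ η * twist θ κ (u - η) * w

theorem dynYBE_100_001 : DynYBE θ κ η x m u 1 0 0 0 0 1 := by
  have g0 : twist θ κ u ≠ 0 := mul_ne_zero (exp_ne_zero _) h0
  have gp : twist θ κ (u + η) ≠ 0 := mul_ne_zero (exp_ne_zero _) hp
  simp [DynYBE, doubleSite, Fin.sum_univ_two, dynR, sz_zero, sz_one]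
  field_simp
  have w := hθ.twist_rel' κ (p := u + η) (q := u + η - x) (p' := u + η + η) (q' := u - x)
    (p'' := u + η - m) (q'' := u + η - (x - m)) (r := x - m + η) (s := m + η) (r' := x - m) (s' := m)
    (r'' := x + η) (s'' := η)
    (by ring) (by ring) (by ring) (by ring) (by ring) (by ring) (by ring) (by ring)
  linear_combination (-θ η) * w

theorem dynYBE_100_010 : DynYBE θ κ η x m u 1 0 0 0 1 0 := by
  have g0 : twist θ κ u ≠ 0 := mul_ne_zero (exp_ne_zero _) h0
  have gp : twist θ κ (u + η) ≠ 0 := mul_ne_zero (exp_ne_zero _) hp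
  simp [DynYBE, doubleSite, Fin.sum_univ_two, dynR, sz_zero, sz_one]
  field_simp
  have w := hθ.twist_rel' κ (p := u + η) (q := u - (x - m)) (p' := u + η + m) (q' := u - x)
    (p'' := u + η - (x - m)) (q'' := u) (r := m + η) (s := x) (r' := η) (s' := x - m)
    (r'' := x + η) (s'' := m)
    (by ring) (by ring) (by ring) (by ring) (by ring) (by ring) (by ring) (by ring)
  linear_combination (-θ η) * w

theorem dynYBE_of_le_one (i₁ i₂ h' j₁ j₂ h : Fin 2) (hs : (i₁ : ℕ) + i₂ + h' ≤ 1) :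
    DynYBE θ κ η x m u i₁ i₂ h' j₁ j₂ h := by
  have H000 : DynYBE θ κ η x m u 0 0 0 0 0 0 := by
    simp [DynYBE, doubleSite, Fin.sum_univ_two, dynR]
    ring
  by_cases hi : (i₁ : ℕ) + i₂ + h' = j₁ + j₂ + h
  swap
  · exact dynYBE_ice _ _ _ _ _ _ _ _ _ _ _ _ hi
  have A : ∀ a b c : Fin 2, (a : ℕ) + b + c ≤ 1 →
      (a = 0 ∧ b = 0 ∧ c = 0) ∨ (a = 0 ∧ b = 0 ∧ c = 1) ∨ (a = 0 ∧ b = 1 ∧ c = 0) ∨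
      (a = 1 ∧ b = 0 ∧ c = 0) := by decide
  obtain ⟨rfl, rfl, rfl⟩ | ⟨rfl, rfl, rfl⟩ | ⟨rfl, rfl, rfl⟩ | ⟨rfl, rfl, rfl⟩ := A _ _ _ hs <;>
  obtain ⟨rfl, rfl, rfl⟩ | ⟨rfl, rfl, rfl⟩ | ⟨rfl, rfl, rfl⟩ | ⟨rfl, rfl, rfl⟩ :=
    A j₁ j₂ h (by omega)
  · exact H000
  · simp at hi
  · simp at hi
  · simp at hi
  · simp at hi
  · exact dynYBE_001_001 ..
  · exact dynYBE_001_010 hθ h0 hp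
  · exact dynYBE_001_100 hθ h0 hp
  · simp at hi
  · exact dynYBE_010_001 hθ h0 hp
  · exact dynYBE_010_010 hθ h0 hp
  · exact dynYBE_010_100 hθ h0 hp
  · simp at hi
  · exact dynYBE_100_001 hθ h0 hp
  · exact dynYBE_100_010 hθ h0 hp
  · exact dynYBE_100_100 h0 hp

end OneDown

/-- By spin reversal, the sectors with two or three down spins reduce to those with at most one. -/
theorem dynYBE {θ : ℂ → ℂ} (hθ : ThreeTerm θ) {κ η x m u : ℂ} (h0 : θ u ≠ 0)
    (hp : θ (u + η) ≠ 0) (hm : θ (u - η) ≠ 0) (i₁ i₂ h' j₁ j₂ h : Fin 2) :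
    DynYBE θ κ η x m u i₁ i₂ h' j₁ j₂ h := by
  by_cases hs : (i₁ : ℕ) + i₂ + h' ≤ 1
  · exact dynYBE_of_le_one hθ h0 hp _ _ _ _ _ _ hs
  · refine dynYBE_flip hθ (dynYBE_of_le_one hθ ?_ ?_ _ _ _ _ _ _ ?_)
    · rwa [hθ.odd, neg_ne_zero]
    · rwa [show -u + η = -(u - η) by ring, hθ.odd, neg_ne_zero]
    · revert hs
      revert i₁ i₂ h'
      decide

/-! ### Rows and pairs of rows -/

section Rows

variable (θ : ℂ → ℂ) (κ η : ℂ)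

/-- The matrix in the auxiliary space of one site with quantum labels `a` (out) and `b` (in). -/
def siteMat (l t : ℂ) (a b : Fin 2) : Matrix (Fin 2) (Fin 2) ℂ :=
  Matrix.of fun i j => dynR θ κ η l t (i, a) (j, b)

/-- The matrix in the auxiliary space of a row with quantum labels `h'` (out) and `h` (in). -/
def rowMat : (N : ℕ) → (Fin N → ℂ) → ℂ → ℂ → Spins N → Spins N → Matrix (Fin 2) (Fin 2) ℂ
  | 0, _, _, _, _, _ => 1
  | N + 1, ξ, l, t, h', h =>
    rowMat N (Fin.tail ξ) l (t + η * sz (h' 0)) (Fin.tail h') (Fin.tail h)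
      * siteMat θ κ η (l - ξ 0) t (h' 0) (h 0)

/-- Two sites on top of each other, as a matrix in the product of two auxiliary spaces. -/
def sitePair (x m u : ℂ) (h' h : Fin 2) : Matrix (Fin 2 × Fin 2) (Fin 2 × Fin 2) ℂ :=
  Matrix.of fun i j => doubleSite θ κ η x m u i.1 i.2 h' j.1 j.2 h

/-- Two rows on top of each other, as a matrix in the product of two auxiliary spaces. -/
def rowPair : (N : ℕ) → (Fin N → ℂ) → ℂ → ℂ → ℂ → Spins N → Spins N →
    Matrix (Fin 2 × Fin 2) (Fin 2 × Fin 2) ℂ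
  | 0, _, _, _, _, _, _ => 1
  | N + 1, ξ, x, m, u, h', h =>
    rowPair N (Fin.tail ξ) x m (u + η * sz (h' 0)) (Fin.tail h') (Fin.tail h)
      * sitePair θ κ η (x - ξ 0) (m - ξ 0) u (h' 0) (h 0)

theorem sum_spins_succ {N : ℕ} (f : Spins (N + 1) → ℂ) :
    ∑ k, f k = ∑ a, ∑ k : Spins N, f (Fin.cons a k) := by
  rw [← (Fin.consEquiv fun _ : Fin (N + 1) => Fin 2).sum_comp, Fintype.sum_prod_type]
  rfl

/-- Identifies the product of two rows, summed over the intermediate spins, with a product of local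
pairs, to which the local Yang–Baxter equation applies. -/
theorem rowPair_apply {N : ℕ} (ξ : Fin N → ℂ) (x m u : ℂ) (h' h : Spins N)
    (i₁ i₂ j₁ j₂ : Fin 2) :
    rowPair θ κ η N ξ x m u h' h (i₁, i₂) (j₁, j₂)
      = ∑ k, rowMat θ κ η N ξ x u h' k i₁ j₁ * rowMat θ κ η N ξ m (u + η * sz j₁) k h i₂ j₂ := by
  induction N generalizing u j₁ j₂ with
  | zero =>
    simp [rowPair, rowMat, Matrix.one_apply, ite_and]
    split_ifs <;> rfl
  | succ N ih =>
    rw [rowPair, Matrix.mul_apply, Fintype.sum_prod_type, sum_spins_succ]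
    simp only [rowMat, Matrix.mul_apply, Fin.cons_zero, Fin.tail_cons, ih, sitePair, siteMat,
      Matrix.of_apply, doubleSite, Finset.sum_mul, Finset.mul_sum]
    symm
    calc _ = ∑ a, ∑ s₂, ∑ k, ∑ s₁, _ := Finset.sum_congr rfl fun a _ => Finset.sum_comm
      _ = ∑ s₂, ∑ a, ∑ k, ∑ s₁, _ := Finset.sum_comm
      _ = ∑ s₂, ∑ a, ∑ s₁, ∑ k, _ := Finset.sum_congr rfl fun s₂ _ =>
          Finset.sum_congr rfl fun a _ => Finset.sum_comm
      _ = ∑ s₂, ∑ s₁, ∑ a, ∑ k, _ := Finset.sum_congr rfl fun s₂ _ => Finset.sum_comm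
      _ = ∑ s₁, ∑ s₂, ∑ a, ∑ k, _ := Finset.sum_comm
      _ = _ := by
        refine Finset.sum_congr rfl fun s₁ _ => Finset.sum_congr rfl fun s₂ _ =>
          Finset.sum_congr rfl fun a _ => Finset.sum_congr rfl fun k _ => ?_
        by_cases hi : (s₁ : ℕ) + h' 0 = j₁ + a
        · have e : sz s₁ + sz (h' 0) = sz j₁ + sz a := by
            have := congrArg (fun n : ℕ => (n : ℂ)) hi
            push_cast at this
            unfold sz
            linear_combination -2 * this
          rw [show u + η * sz j₁ + η * sz a = u + η * sz (h' 0) + η * sz s₁ by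
            linear_combination -η * e]
          ring
        · rw [dynR_ice θ κ η (x - ξ 0) u s₁ (h' 0) j₁ a hi]
          ring

/-- The `R`-matrix with its indices read as an operator. -/
def rMat (l t : ℂ) : Matrix (Fin 2 × Fin 2) (Fin 2 × Fin 2) ℂ := Matrix.of (dynR θ κ η l t)

theorem rMat_one_one (l t : ℂ) (M : Matrix (Fin 2 × Fin 2) (Fin 2 × Fin 2) ℂ)
    (j : Fin 2 × Fin 2) : (rMat θ κ η l t * M) (1, 1) j = θ (l + η) * M (1, 1) j := by
  simp [Matrix.mul_apply, Fintype.sum_prod_type, rMat, dynR]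

theorem mul_rMat_zero_zero (l t : ℂ) (M : Matrix (Fin 2 × Fin 2) (Fin 2 × Fin 2) ℂ)
    (i : Fin 2 × Fin 2) : (M * rMat θ κ η l t) i (0, 0) = M i (0, 0) * θ (l + η) := by
  simp [Matrix.mul_apply, Fintype.sum_prod_type, rMat, dynR]

/-- All the shifts of the dynamical parameter by multiples of `η` are regular. -/
def Regular (t : ℂ) : Prop := ∀ k : ℤ, θ (t + k * η) ≠ 0

variable {θ η}

theorem Regular.shift {t : ℂ} (h : Regular θ η t) (k : ℤ) : Regular θ η (t + k * η) := fun j => by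
  have := h (k + j)
  push_cast at this
  rwa [add_assoc, ← add_mul]

theorem Regular.add {t : ℂ} (h : Regular θ η t) : Regular θ η (t + η) := by
  simpa using h.shift 1

theorem Regular.sub {t : ℂ} (h : Regular θ η t) : Regular θ η (t - η) := by
  simpa [sub_eq_add_neg] using h.shift (-1)

theorem Regular.sz {t : ℂ} (h : Regular θ η t) (a : Fin 2) : Regular θ η (t + η * sz a) := by
  fin_cases a
  · simpa [sz_zero] using h.add
  · simpa [sz_one, ← sub_eq_add_neg] using h.sub

theorem Regular.ne_zero {t : ℂ} (h : Regular θ η t) : θ t ≠ 0 := by simpa using h 0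

theorem Regular.twist_ne_zero {t : ℂ} (h : Regular θ η t) : twist θ κ t ≠ 0 :=
  mul_ne_zero (exp_ne_zero _) h.ne_zero

variable (hθ : ThreeTerm θ)
include hθ

theorem sitePair_rMat {u : ℂ} (hu : Regular θ η u) (x m : ℂ) (h' h : Fin 2) :
    rMat θ κ η (x - m) (u + η * SOS.sz h') * sitePair θ κ η x m u h' h
      = (sitePair θ κ η m x u h' h).submatrix Prod.swap Prod.swap * rMat θ κ η (x - m) u := by
  ext ⟨i₁, i₂⟩ ⟨j₁, j₂⟩
  have := dynYBE hθ (κ := κ) (x := x) (m := m) hu.ne_zero hu.add.ne_zero hu.sub.ne_zero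
    i₁ i₂ h' j₁ j₂ h
  unfold DynYBE at this
  simpa [Matrix.mul_apply, Fintype.sum_prod_type, rMat, sitePair] using this

/-- `R` is pulled through the sites one at a time. The parameter `u'` at which it comes out depends
on `h'`; its value is immaterial, since the row `(1,1)` of `R` does not involve it. -/
theorem rowPair_rMat {N : ℕ} (ξ : Fin N → ℂ) {u : ℂ} (hu : Regular θ η u) (x m : ℂ)
    (h' h : Spins N) :
    ∃ u', rMat θ κ η (x - m) u' * rowPair θ κ η N ξ x m u h' h
      = (rowPair θ κ η N ξ m x u h' h).submatrix Prod.swap Prod.swap * rMat θ κ η (x - m) u := by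
  induction N generalizing u with
  | zero =>
    refine ⟨u, ?_⟩
    simp only [rowPair, Matrix.mul_one]
    rw [show (Prod.swap : Fin 2 × Fin 2 → _) = Equiv.prodComm _ _ from rfl,
      Matrix.submatrix_one_equiv, Matrix.one_mul]
  | succ N ih =>
    obtain ⟨u', e⟩ := ih (Fin.tail ξ) (hu.sz (h' 0)) (Fin.tail h') (Fin.tail h)
    refine ⟨u', ?_⟩
    have s := sitePair_rMat κ hθ hu (x - ξ 0) (m - ξ 0) (h' 0) (h 0)
    rw [sub_sub_sub_cancel_right] at s
    rw [rowPair, ← Matrix.mul_assoc, e, Matrix.mul_assoc, s, ← Matrix.mul_assoc, rowPair]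
    rw [show (Prod.swap : Fin 2 × Fin 2 → _) = Equiv.prodComm _ _ from rfl,
      Matrix.submatrix_mul_equiv]

/-- In the entry `(1,1), (0,0)` only diagonal entries of `R` contribute, with the same weight `θ(x -
m + η)` on both sides. -/
theorem rowPair_comm {N : ℕ} (ξ : Fin N → ℂ) {u : ℂ} (hu : Regular θ η u) {x m : ℂ}
    (hxm : θ (x - m + η) ≠ 0) (h' h : Spins N) :
    rowPair θ κ η N ξ x m u h' h (1, 1) (0, 0) = rowPair θ κ η N ξ m x u h' h (1, 1) (0, 0) := by
  obtain ⟨u', e⟩ := rowPair_rMat κ hθ ξ hu x m h' h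
  have := congrFun (congrFun e (1, 1)) (0, 0)
  rw [rMat_one_one, mul_rMat_zero_zero, mul_comm] at this
  exact mul_right_cancel₀ hxm this

/-- At spectral parameter `0` the upper `R` is `θ(η)` times the permutation, so the pair of sites
collapses to one `R(-η)`. -/
theorem sitePair_zero {u : ℂ} (hu : Regular θ η u) (h' h i₁ i₂ j₁ j₂ : Fin 2) :
    sitePair θ κ η 0 (-η) u h' h (i₁, i₂) (j₁, j₂)
      = if h' = j₁ then θ η * rMat θ κ η (-η) (u + η * SOS.sz h') (i₂, i₁) (j₂, h) else 0 := by
  have h0 := hu.twist_ne_zero κ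
  have e : ∀ k, dynR θ κ η 0 u (i₁, h') (j₁, k) = if i₁ = k ∧ h' = j₁ then θ η else 0 := by
    intro k
    fin_cases i₁ <;> fin_cases h' <;> fin_cases j₁ <;> fin_cases k <;>
      simp [dynR, hθ.zero, h0]
  simp only [sitePair, Matrix.of_apply, doubleSite, e, ite_and, ite_mul, zero_mul,
    Finset.sum_ite_eq, Finset.mem_univ, if_true, rMat]
  split_ifs with hj
  · rw [hj]
  · rfl

/-- Sites before `n` are peeled off by induction. At site `n` the pair collapses to `R(-η)`, which
is then pulled through the remaining sites. -/
theorem rowPair_fusion {N : ℕ} (ξ : Fin N → ℂ) {u : ℂ} (hu : Regular θ η u) (n : Fin N)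
    (h' h : Spins N) (j : Fin 2 × Fin 2) :
    rowPair θ κ η N ξ (ξ n) (ξ n - η) u h' h (1, 1) j = 0 := by
  induction N generalizing u j with
  | zero => exact n.elim0
  | succ N ih =>
    rw [rowPair, Matrix.mul_apply]
    induction n using Fin.cases with
    | succ n =>
      exact Finset.sum_eq_zero fun i _ => by
        rw [show ξ n.succ = Fin.tail ξ n from rfl, ih (Fin.tail ξ) (hu.sz _), zero_mul]
    | zero =>
      obtain ⟨j₁, j₂⟩ := j
      -- On the far side the row `(1,1)` of `R(-η)` has weight `θ(-η + η) = 0`.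
      obtain ⟨u', e⟩ := rowPair_rMat κ hθ (Fin.tail ξ) (hu.sz (h' 0)) (ξ 0 - η) (ξ 0)
        (Fin.tail h') (Fin.tail h)
      have := congrFun (congrFun e (1, 1)) (j₂, h 0)
      rw [rMat_one_one, sub_sub_cancel_left, neg_add_cancel, hθ.zero, zero_mul, Matrix.mul_apply,
        Fintype.sum_prod_type, Finset.sum_comm] at this
      simp only [Matrix.submatrix_apply, Prod.swap_prod_mk] at this
      rw [sub_self, sub_sub_cancel_left, Fintype.sum_prod_type]
      simp only [sitePair_zero κ hθ hu]
      split_ifs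
      · simp_rw [mul_left_comm _ (θ η), ← Finset.mul_sum]
        rw [← this, mul_zero]
      · simp

end Rows

/-! ### Products of the operators `𝓒` -/

section Chain

variable (θ : ℂ → ℂ) (κ η : ℂ)

/-- The entry `𝖢(l | t)` of the monodromy matrix, as a matrix in the quantum space. -/
def cMat {N : ℕ} (ξ : Fin N → ℂ) (l t : ℂ) : Matrix (Spins N) (Spins N) ℂ :=
  Matrix.of fun h' h => rowMat θ κ η N ξ l t h' h 1 0

/-- The product of the `𝖢(l | ·)` for `l` in a list; the dynamical parameter of the leftmost factor
is `t`, and it grows by `η` at each step to the right. -/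
def chain {N : ℕ} (ξ : Fin N → ℂ) : List ℂ → ℂ → Matrix (Spins N) (Spins N) ℂ
  | [], _ => 1
  | l :: ls, t => cMat θ κ η ξ l t * chain ξ ls (t + η)

theorem chain_append {N : ℕ} (ξ : Fin N → ℂ) (ls ls' : List ℂ) (t : ℂ) :
    chain θ κ η ξ (ls ++ ls') t
      = chain θ κ η ξ ls t * chain θ κ η ξ ls' (t + ls.length * η) := by
  induction ls generalizing t with
  | nil => simp [chain]
  | cons l ls ih =>
    simp only [List.cons_append, chain, ih, Matrix.mul_assoc, List.length_cons]
    congr 3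
    push_cast
    ring

theorem rowMat_ice {N : ℕ} (ξ : Fin N → ℂ) (l t : ℂ) (h' h : Spins N) (i j : Fin 2)
    (hs : (i : ℕ) + ∑ k, (h' k : ℕ) ≠ j + ∑ k, (h k : ℕ)) :
    rowMat θ κ η N ξ l t h' h i j = 0 := by
  induction N generalizing t j with
  | zero =>
    rw [rowMat, Matrix.one_apply_ne]
    rintro rfl
    simp at hs
  | succ N ih =>
    rw [rowMat, Matrix.mul_apply]
    refine Finset.sum_eq_zero fun s _ => ?_
    simp only [Fin.sum_univ_succ] at hs
    by_cases h1 : (s : ℕ) + h' 0 = j + h 0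
    · rw [ih, zero_mul]
      simp only [Fin.tail]
      omega
    · rw [siteMat, Matrix.of_apply, dynR_ice _ _ _ _ _ _ _ _ _ h1, mul_zero]

theorem chain_ice {N : ℕ} (ξ : Fin N → ℂ) (ls : List ℂ) (t : ℂ) (h' h : Spins N)
    (hs : ls.length + ∑ k, (h' k : ℕ) ≠ ∑ k, (h k : ℕ)) : chain θ κ η ξ ls t h' h = 0 := by
  induction ls generalizing t h' with
  | nil =>
    rw [chain, Matrix.one_apply_ne]
    rintro rfl
    simp at hs
  | cons l ls ih =>
    rw [chain, Matrix.mul_apply]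
    refine Finset.sum_eq_zero fun k _ => ?_
    by_cases h1 : 1 + ∑ i, (h' i : ℕ) = ∑ i, (k i : ℕ)
    · rw [ih, mul_zero]
      rw [List.length_cons] at hs
      omega
    · rw [cMat, Matrix.of_apply, rowMat_ice, zero_mul]
      simpa using h1

variable {θ η}

/-! ### Exchange and fusion relations for `𝖢` -/

section Commute

variable (hθ : ThreeTerm θ)

theorem cMat_mul_cMat {N : ℕ} (ξ : Fin N → ℂ) (x m t : ℂ) (h' h : Spins N) :
    (cMat θ κ η ξ x t * cMat θ κ η ξ m (t + η)) h' h
      = rowPair θ κ η N ξ x m t h' h (1, 1) (0, 0) := by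
  rw [rowPair_apply, Matrix.mul_apply]
  simp [cMat, sz_zero]

include hθ

theorem cMat_comm {N : ℕ} (ξ : Fin N → ℂ) {t : ℂ} (ht : Regular θ η t) {x m : ℂ}
    (hxm : θ (x - m + η) ≠ 0 ∨ θ (m - x + η) ≠ 0) :
    cMat θ κ η ξ x t * cMat θ κ η ξ m (t + η) = cMat θ κ η ξ m t * cMat θ κ η ξ x (t + η) := by
  ext h' h
  rw [cMat_mul_cMat κ, cMat_mul_cMat κ]
  rcases hxm with hxm | hxm
  · exact rowPair_comm κ hθ ξ ht hxm h' h
  · exact (rowPair_comm κ hθ ξ ht hxm h' h).symm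

theorem cMat_fusion {N : ℕ} (ξ : Fin N → ℂ) {t : ℂ} (ht : Regular θ η t) (n : Fin N) :
    cMat θ κ η ξ (ξ n) t * cMat θ κ η ξ (ξ n - η) (t + η) = 0 := by
  ext h' h
  rw [cMat_mul_cMat κ, rowPair_fusion κ hθ ξ ht]
  rfl

theorem chain_move {N : ℕ} (ξ : Fin N → ℂ) {t : ℂ} (ht : Regular θ η t) (ls ls' : List ℂ) (x : ℂ)
    (hx : ∀ m ∈ ls, θ (x - m + η) ≠ 0 ∨ θ (m - x + η) ≠ 0) :
    chain θ κ η ξ (ls ++ x :: ls') t = chain θ κ η ξ (x :: (ls ++ ls')) t := by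
  induction ls generalizing t with
  | nil => rfl
  | cons m ls ih =>
    rw [List.cons_append, chain, ih ht.add fun m hm => hx m (by simp [hm]), chain,
      ← Matrix.mul_assoc, ← cMat_comm κ hθ ξ ht (hx m (by simp)), Matrix.mul_assoc]
    rfl

/-- Both parameters of site `n` are moved to the front, past factors with which exchange is
permitted; they are never exchanged with each other. -/
theorem chain_fusion {N : ℕ} (ξ : Fin N → ℂ) {t : ℂ} (ht : Regular θ η t) (ls ls' ls'' : List ℂ)
    (n : Fin N)
    (h₁ : ∀ m ∈ ls, θ (ξ n - m + η) ≠ 0 ∨ θ (m - ξ n + η) ≠ 0)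
    (h₂ : ∀ m ∈ ls ++ ls', θ (ξ n - η - m + η) ≠ 0 ∨ θ (m - (ξ n - η) + η) ≠ 0) :
    chain θ κ η ξ (ls ++ ξ n :: (ls' ++ (ξ n - η) :: ls'')) t = 0 := by
  rw [chain_move κ hθ ξ ht _ _ _ h₁, chain, ← List.append_assoc,
    chain_move κ hθ ξ ht.add _ _ _ h₂, chain, ← Matrix.mul_assoc, cMat_fusion κ hθ ξ ht,
    Matrix.zero_mul]

end Commute

/-! ### Freezing the first site -/

section Freeze

variable {N : ℕ} (ξ : Fin (N + 1) → ℂ)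

/-- In the first spin `𝖢` is block triangular. The diagonal block `0, 0` vanishes at `l = ξ 0 - η`
and the block `1, 1` at `l = ξ 0`; these zeros force the flip of the first spin below. -/
theorem cMat_cons_zero_zero (l t : ℂ) (h' h : Spins N) :
    cMat θ κ η ξ l t (Fin.cons 0 h') (Fin.cons 0 h)
      = θ (l - ξ 0 + η) * cMat θ κ η (Fin.tail ξ) l (t + η) h' h := by
  simp [cMat, rowMat, Matrix.mul_apply, siteMat, dynR, sz_zero, mul_comm]

theorem cMat_cons_one_one (l t : ℂ) (h' h : Spins N) :
    cMat θ κ η ξ l t (Fin.cons 1 h') (Fin.cons 1 h)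
      = θ (l - ξ 0) * (twist θ κ (t + η) / twist θ κ t)
        * cMat θ κ η (Fin.tail ξ) l (t - η) h' h := by
  simp [cMat, rowMat, Matrix.mul_apply, siteMat, dynR, sz_one, sub_eq_add_neg]
  ring

theorem cMat_cons_one_zero (l t : ℂ) (h' h : Spins N) :
    cMat θ κ η ξ l t (Fin.cons 1 h') (Fin.cons 0 h) = 0 := by
  simp [cMat, rowMat, Matrix.mul_apply, siteMat, dynR]

theorem cMat_cons_zero_one (l t : ℂ) (h' h : Spins N) :
    cMat θ κ η ξ l t (Fin.cons 0 h') (Fin.cons 1 h)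
      = θ η * twist θ κ (t - (l - ξ 0)) / twist θ κ t
        * rowMat θ κ η N (Fin.tail ξ) l (t + η) h' h 1 1 := by
  simp [cMat, rowMat, Matrix.mul_apply, siteMat, dynR, sz_zero]
  ring

theorem sum_spins_cons (f : Spins (N + 1) → ℂ) :
    ∑ k, f k = ∑ k : Spins N, f (Fin.cons 0 k) + ∑ k : Spins N, f (Fin.cons 1 k) := by
  rw [sum_spins_succ, Fin.sum_univ_two]

theorem chain_cons_one_zero (ls : List ℂ) (t : ℂ) (h' h : Spins N) :
    chain θ κ η ξ ls t (Fin.cons 1 h') (Fin.cons 0 h) = 0 := by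
  induction ls generalizing t h' with
  | nil =>
    rw [chain, Matrix.one_apply_ne]
    intro e
    simpa using congrFun e 0
  | cons l ls ih =>
    rw [chain, Matrix.mul_apply, sum_spins_cons]
    simp [cMat_cons_one_zero, ih]

theorem chain_cons_zero_zero (ls : List ℂ) (t : ℂ) (h' h : Spins N) :
    chain θ κ η ξ ls t (Fin.cons 0 h') (Fin.cons 0 h)
      = (ls.map fun l => θ (l - ξ 0 + η)).prod * chain θ κ η (Fin.tail ξ) ls (t + η) h' h := by
  induction ls generalizing t h' with
  | nil => simp [chain, Matrix.one_apply]
  | cons l ls ih =>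
    rw [chain, Matrix.mul_apply, sum_spins_cons, chain, Matrix.mul_apply, Finset.mul_sum]
    simp only [chain_cons_one_zero, mul_zero, Finset.sum_const_zero, add_zero, ih,
      cMat_cons_zero_zero, List.map_cons, List.prod_cons]
    refine Finset.sum_congr rfl fun k _ => ?_
    ring

/-- The twisted ratios of consecutive factors telescope. -/
theorem chain_cons_one_one {t : ℂ} (ht : Regular θ η t) (ls : List ℂ) (h' h : Spins N) :
    chain θ κ η ξ ls t (Fin.cons 1 h') (Fin.cons 1 h)
      = (ls.map fun l => θ (l - ξ 0)).prod * (twist θ κ (t + ls.length * η) / twist θ κ t)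
        * chain θ κ η (Fin.tail ξ) ls (t - η) h' h := by
  have ht0 := ht.twist_ne_zero κ
  induction ls generalizing t h' with
  | nil => simp [chain, Matrix.one_apply, ht0]
  | cons l ls ih =>
    rw [chain, Matrix.mul_apply, sum_spins_cons, chain, Matrix.mul_apply, Finset.mul_sum]
    have ht1 := ht.add.twist_ne_zero κ
    simp only [cMat_cons_one_zero, zero_mul, Finset.sum_const_zero, zero_add, ih ht.add _ ht1,
      cMat_cons_one_one, List.map_cons, List.prod_cons, List.length_cons]
    refine Finset.sum_congr rfl fun k _ => ?_
    rw [show t + η - η = t - η + η by ring,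
      show t + η + ls.length * η = t + ((ls.length + 1 : ℕ) : ℂ) * η by push_cast; ring]
    field_simp

end Freeze

theorem rowMat_one_one_down {N : ℕ} (ξ : Fin N → ℂ) (l t : ℂ) (h' : Spins N) :
    rowMat θ κ η N ξ l t h' 1 1 1 = if h' = 1 then ∏ n, θ (l - ξ n + η) else 0 := by
  induction N generalizing t with
  | zero => simp [rowMat, Subsingleton.elim h' 1]
  | succ N ih =>
    obtain ⟨a, k, rfl⟩ : ∃ a k, h' = Fin.cons a k := ⟨h' 0, Fin.tail h', by simp⟩
    have e1 : Fin.tail (1 : Spins (N + 1)) = 1 := rfl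
    have e2 : (Fin.cons a k : Spins (N + 1)) = 1 ↔ a = 1 ∧ k = 1 := by
      rw [← Fin.cons_self_tail (1 : Spins (N + 1)), Fin.cons_inj, e1]; rfl
    rw [rowMat, Matrix.mul_apply, Fin.sum_univ_two, e1, Fin.tail_cons, Fin.cons_zero, ih,
      Fin.prod_univ_succ]
    simp only [e2]
    fin_cases a <;> simp [siteMat, dynR, Fin.tail, mul_comm]

/-- Only diagonal weights contribute to `𝖣` on the all-up state, and their twisted ratios telescope
along the row. -/
theorem rowMat_one_one_up {N : ℕ} (ξ : Fin N → ℂ) (l : ℂ) {t : ℂ} (ht : Regular θ η t) :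
    rowMat θ κ η N ξ l t 0 0 1 1
      = (∏ n, θ (l - ξ n)) * (twist θ κ (t - η) / twist θ κ (t - η + N * η)) := by
  have h1 := ht.sub.twist_ne_zero κ
  induction N generalizing t with
  | zero => simp [rowMat, h1]
  | succ N ih =>
    have h2 := ht.twist_ne_zero κ
    have e1 : Fin.tail (0 : Spins (N + 1)) = 0 := rfl
    have h3 := ih (Fin.tail ξ) ht.add (by rwa [add_sub_cancel_right])
    rw [add_sub_cancel_right] at h3
    rw [rowMat, Matrix.mul_apply, Fin.sum_univ_two, e1, Pi.zero_apply, sz_zero, mul_one, h3,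
      Fin.prod_univ_succ, show t - η + ((N + 1 : ℕ) : ℂ) * η = t + N * η by push_cast; ring]
    simp [siteMat, dynR, Fin.tail]
    field_simp

end Chain

/-! ### Matrix elements between the reference states -/

/-- The list in which `ζ n` occurs `k n` times. -/
def multiList {N : ℕ} (ζ : Fin N → ℂ) (k : Fin N → ℕ) : List ℂ :=
  (List.ofFn fun n => List.replicate (k n) (ζ n)).flatten

section MultiList

variable {N : ℕ}

theorem multiList_succ (ζ : Fin (N + 1) → ℂ) (k : Fin (N + 1) → ℕ) :
    multiList ζ k = List.replicate (k 0) (ζ 0) ++ multiList (Fin.tail ζ) (Fin.tail k) := by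
  simp [multiList, List.ofFn_succ, Fin.tail]

theorem length_multiList (ζ : Fin N → ℂ) (k : Fin N → ℕ) :
    (multiList ζ k).length = ∑ n, k n := by
  induction N with
  | zero => simp [multiList]
  | succ N ih => rw [multiList_succ, List.length_append, ih, Fin.sum_univ_succ]; simp [Fin.tail]

theorem prod_map_multiList {M : Type*} [Monoid M] (f : ℂ → M) (ζ : Fin N → ℂ) (k : Fin N → ℕ) :
    ((multiList ζ k).map f).prod = (List.ofFn fun n => f (ζ n) ^ k n).prod := by
  induction N with
  | zero => simp [multiList]
  | succ N ih =>
    rw [multiList_succ, List.map_append, List.prod_append, ih, List.ofFn_succ, List.prod_cons]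
    simp [Fin.tail]

theorem mem_multiList {ζ : Fin N → ℂ} {k : Fin N → ℕ} {x : ℂ} (h : x ∈ multiList ζ k) :
    ∃ n, x = ζ n := by
  simp only [multiList, List.mem_flatten, List.mem_ofFn] at h
  obtain ⟨_, ⟨n, rfl⟩, hx⟩ := h
  exact ⟨n, List.eq_of_mem_replicate hx⟩

/-- Isolates the occurrences that come from the index `n`. The other entries are recorded by index,
since the exchange conditions concern distinct sites. -/
theorem multiList_split (ζ : Fin N → ℂ) (k : Fin N → ℕ) (n : Fin N) :
    ∃ ls ls', multiList ζ k = ls ++ (List.replicate (k n) (ζ n) ++ ls') ∧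
      (∀ x ∈ ls, ∃ m, m ≠ n ∧ x = ζ m) ∧ ∀ x ∈ ls', ∃ m, m ≠ n ∧ x = ζ m := by
  induction N with
  | zero => exact n.elim0
  | succ N ih =>
    induction n using Fin.cases with
    | zero =>
      refine ⟨[], _, multiList_succ ζ k, by simp, fun x hx => ?_⟩
      obtain ⟨m, rfl⟩ := mem_multiList hx
      exact ⟨m.succ, Fin.succ_ne_zero m, rfl⟩
    | succ n =>
      obtain ⟨ls, ls', e, hls, hls'⟩ := ih (Fin.tail ζ) (Fin.tail k) n
      refine ⟨List.replicate (k 0) (ζ 0) ++ ls, ls', ?_, fun x hx => ?_, fun x hx => ?_⟩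
      · rw [multiList_succ, e, List.append_assoc]
        rfl
      · rcases List.mem_append.1 hx with hx | hx
        · exact ⟨0, (Fin.succ_ne_zero n).symm, List.eq_of_mem_replicate hx⟩
        · obtain ⟨m, hm, rfl⟩ := hls x hx
          exact ⟨m.succ, fun h => hm (Fin.succ_injective _ h), rfl⟩
      · obtain ⟨m, hm, rfl⟩ := hls' x hx
        exact ⟨m.succ, fun h => hm (Fin.succ_injective _ h), rfl⟩

end MultiList

/-! ### Orthogonality and norms of the SOV states -/

/-- The spectral parameters of the operators `𝓒` in `⟨r, h | h', r'⟩`. -/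
def sovList {N : ℕ} (η : ℂ) (ξ : Fin N → ℂ) (h h' : Spins N) : List ℂ :=
  multiList ξ (fun n => (h n : ℕ)) ++ multiList (fun n => ξ n - η) (fun n => 1 - (h' n : ℕ))

/-- The genericity condition on the inhomogeneities. -/
structure Generic {N : ℕ} (θ : ℂ → ℂ) (η : ℂ) (ξ : Fin N → ℂ) : Prop where
  eta : θ η ≠ 0
  zero : ∀ a b : Fin N, a ≠ b → θ (ξ a - ξ b) ≠ 0
  add : ∀ a b, a ≠ b → θ (ξ a - ξ b + η) ≠ 0
  sub : ∀ a b, a ≠ b → θ (ξ a - ξ b - η) ≠ 0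

section Sov

variable {θ : ℂ → ℂ} {κ η : ℂ} {N : ℕ}

theorem Generic.tail {ξ : Fin (N + 1) → ℂ} (h : Generic θ η ξ) : Generic θ η (Fin.tail ξ) where
  eta := h.eta
  zero _ _ hab := h.zero _ _ fun e => hab (Fin.succ_injective _ e)
  add _ _ hab := h.add _ _ fun e => hab (Fin.succ_injective _ e)
  sub _ _ hab := h.sub _ _ fun e => hab (Fin.succ_injective _ e)

theorem length_sovList (ξ : Fin N → ℂ) (h h' : Spins N) :
    (sovList η ξ h h').length = ∑ n, (h n : ℕ) + ∑ n, (1 - (h' n : ℕ)) := by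
  rw [sovList, List.length_append, length_multiList, length_multiList]

theorem length_sovList_self (ξ : Fin N → ℂ) (h : Spins N) : (sovList η ξ h h).length = N := by
  rw [length_sovList, ← Finset.sum_add_distrib]
  have : ∀ n, (h n : ℕ) + (1 - (h n : ℕ)) = 1 := fun n => by omega
  simp [this]

theorem sum_spins_add (h : Spins N) : ∑ n, (1 - (h n : ℕ)) + ∑ n, (h n : ℕ) = N := by
  rw [← Finset.sum_add_distrib]
  have : ∀ n, (1 - (h n : ℕ)) + (h n : ℕ) = 1 := fun n => by omega
  simp [this]

/-- The exchange condition between distinct sites. Within a site it would need `θ(2η) ≠ 0`, which is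
not assumed. -/
theorem Generic.good {ξ : Fin N → ℂ} (hg : Generic θ η ξ) {a b : Fin N} (hab : a ≠ b)
    {x m : ℂ} (hx : x = ξ a ∨ x = ξ a - η) (hm : m = ξ b ∨ m = ξ b - η) :
    θ (x - m + η) ≠ 0 ∨ θ (m - x + η) ≠ 0 := by
  rcases hx with rfl | rfl <;> rcases hm with rfl | rfl
  · exact .inl (hg.add a b hab)
  · right
    have := hg.zero b a hab.symm
    rwa [show ξ b - η - ξ a + η = ξ b - ξ a by ring]
  · left
    have := hg.zero a b hab
    rwa [show ξ a - η - ξ b + η = ξ a - ξ b by ring]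
  · left
    have := hg.add a b hab
    rwa [sub_sub_sub_cancel_right]

variable (hθ : ThreeTerm θ)
include hθ

theorem chain_sov_off {ξ : Fin N → ℂ} (hg : Generic θ η ξ) {t : ℂ} (ht : Regular θ η t)
    {h h' : Spins N} (hne : h ≠ h') :
    chain θ κ η ξ (sovList η ξ h h') t 0 1 = 0 := by
  by_cases hl : (sovList η ξ h h').length = N
  swap
  · exact chain_ice _ _ _ _ _ _ _ _ (by simpa using hl)
  -- Otherwise `h ≤ h'` pointwise, while the length `N` forces equal sums, hence `h = h'`.
  obtain ⟨n, hn, hn'⟩ : ∃ n, h n = 1 ∧ h' n = 0 := by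
    by_contra! hc
    have hle : ∀ n, (h n : ℕ) ≤ h' n := fun n => by
      have := hc n
      revert this
      generalize h n = a, h' n = b
      revert a b
      decide
    have hs : ∑ n, (h n : ℕ) = ∑ n, (h' n : ℕ) := by
      have := sum_spins_add h'
      rw [length_sovList] at hl
      omega
    exact hne (funext fun n => Fin.ext
      ((Finset.sum_eq_sum_iff_of_le fun n _ => hle n).1 hs n (Finset.mem_univ n)))
  obtain ⟨l₁, l₂, e, hm, hm₂⟩ := multiList_split ξ (fun n => (h n : ℕ)) n
  obtain ⟨l₃, l₄, e', hm', -⟩ := multiList_split (fun n => ξ n - η) (fun n => 1 - (h' n : ℕ)) n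
  have : sovList η ξ h h' = l₁ ++ ξ n :: ((l₂ ++ l₃) ++ (ξ n - η) :: l₄) := by
    simp [sovList, e, e', hn, hn']
  rw [this, chain_fusion κ hθ ξ ht]
  · rfl
  · intro x hx
    obtain ⟨b, hb, rfl⟩ := hm x hx
    exact hg.good hb.symm (.inl rfl) (.inl rfl)
  · intro x hx
    simp only [List.mem_append] at hx
    rcases hx with hx | hx | hx
    · obtain ⟨b, hb, rfl⟩ := hm x hx
      exact hg.good hb.symm (.inr rfl) (.inl rfl)
    · obtain ⟨b, hb, rfl⟩ := hm₂ x hx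
      exact hg.good hb.symm (.inr rfl) (.inl rfl)
    · obtain ⟨b, hb, rfl⟩ := hm' x hx
      exact hg.good hb.symm (.inr rfl) (.inr rfl)

/-- Moved to the far right, `𝖢(ξ 0)` meets the all-down state, where leaving the first spin down
costs `θ(0)`. It therefore flips that spin, `𝖣` of the other sites acts by a scalar, and the
remaining factors see a first spin fixed up. -/
theorem chain_freeze_up {ξ : Fin (N + 1) → ℂ} (hg : Generic θ η ξ) {t : ℂ} (ht : Regular θ η t)
    {ls : List ℂ} (hls : ∀ x ∈ ls, ∃ n, n ≠ 0 ∧ (x = ξ n ∨ x = ξ n - η)) :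
    chain θ κ η ξ (ξ 0 :: ls) t 0 1 = θ η * (∏ n, θ (ξ 0 - Fin.tail ξ n + η))
      * (ls.map fun l => θ (l - ξ 0 + η)).prod * chain θ κ η (Fin.tail ξ) ls (t + η) 0 1 := by
  have e0 : (0 : Spins (N + 1)) = Fin.cons 0 0 := (Fin.cons_self_tail 0).symm
  have e1 : (1 : Spins (N + 1)) = Fin.cons 1 1 := (Fin.cons_self_tail 1).symm
  have hm := chain_move κ hθ ξ ht ls [] (ξ 0) fun m hm => by
    obtain ⟨n, hn, hx⟩ := hls m hm
    exact hg.good hn.symm (.inl rfl) hx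
  rw [List.append_nil] at hm
  have ht' : Regular θ η (t + ls.length * η) := by simpa using ht.shift ls.length
  have ht0 := ht'.twist_ne_zero κ
  rw [← hm, chain_append, Matrix.mul_apply, sum_spins_cons, e0, e1]
  simp only [chain, Matrix.mul_one, cMat_cons_zero_one, cMat_cons_one_one, chain_cons_zero_zero,
    rowMat_one_one_down, sub_self, hθ.zero, sub_zero]
  rw [Finset.sum_eq_single 1 (fun k _ hk => by simp [hk]) (by simp)]
  simp only [if_true, zero_mul, mul_zero, Finset.sum_const_zero, add_zero]
  generalize twist θ κ (t + ls.length * η) = w at ht0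
  field_simp

/-- The mirror argument: `𝖢(ξ 0 - η)`, moved to the far left, meets the all-up covector, must flip
the first spin, and leaves it fixed down for the other factors. -/
theorem chain_freeze_down {ξ : Fin (N + 1) → ℂ} (hg : Generic θ η ξ) {t : ℂ}
    (ht : Regular θ η t) {ls ls' : List ℂ} (hN : (ls ++ ls').length = N)
    (hls : ∀ x ∈ ls, ∃ n, n ≠ 0 ∧ (x = ξ n ∨ x = ξ n - η)) :
    chain θ κ η ξ (ls ++ (ξ 0 - η) :: ls') t 0 1
      = θ η * (∏ n, θ (ξ 0 - Fin.tail ξ n - η))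
        * ((ls ++ ls').map fun l => θ (l - ξ 0)).prod
        * (twist θ κ (t + (N + 1) * η) / twist θ κ (t + N * η))
        * chain θ κ η (Fin.tail ξ) (ls ++ ls') t 0 1 := by
  have e0 : (0 : Spins (N + 1)) = Fin.cons 0 0 := (Fin.cons_self_tail 0).symm
  have e1 : (1 : Spins (N + 1)) = Fin.cons 1 1 := (Fin.cons_self_tail 1).symm
  rw [chain_move κ hθ ξ ht ls ls' (ξ 0 - η) fun m hm => by
    obtain ⟨n, hn, hx⟩ := hls m hm
    exact hg.good hn.symm (.inr rfl) hx]
  have ht0 := ht.twist_ne_zero κ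
  have ht1 := ht.add.twist_ne_zero κ
  have ht2 : twist θ κ (t + N * η) ≠ 0 := by simpa using (ht.shift N).twist_ne_zero κ
  have hr : ∀ k : Spins N, k ≠ 0 →
      rowMat θ κ η N (Fin.tail ξ) (ξ 0 - η) (t + η) 0 k 1 1 = 0 := fun k hk => by
    refine rowMat_ice _ _ _ _ _ _ _ _ _ _ fun h => hk ?_
    simp only [Pi.zero_apply, Fin.val_zero, Finset.sum_const_zero, Nat.add_left_cancel_iff] at h
    exact funext fun n => Fin.ext (Finset.sum_eq_zero_iff.1 h.symm n (Finset.mem_univ n))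
  rw [chain, Matrix.mul_apply, sum_spins_cons, e0, e1]
  simp only [cMat_cons_zero_zero, cMat_cons_zero_one, chain_cons_one_one κ ξ ht.add, hN,
    sub_sub_cancel_left, neg_add_cancel, hθ.zero, sub_neg_eq_add, add_sub_cancel_right,
    zero_mul, Finset.sum_const_zero, zero_add]
  rw [Finset.sum_eq_single (0 : Spins N) (fun k _ hk => by simp [hr k hk]) (by simp),
    rowMat_one_one_up κ _ _ ht.add, add_sub_cancel_right]
  rw [show t + η + N * η = t + (N + 1) * η by ring]
  simp_rw [sub_right_comm (ξ 0) η]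
  generalize twist θ κ (t + N * η) = w at ht2
  field_simp

/-- The ratio between the Vandermonde-type products at `ξ` and at the shifted points. -/
def pairRatio (θ : ℂ → ℂ) (η : ℂ) {N : ℕ} (ξ : Fin N → ℂ) (h : Spins N) : ℂ :=
  ∏ i, ∏ j ∈ Finset.Ioi i, θ (ξ i - ξ j) / θ (ξ i - η * (h i : ℕ) - (ξ j - η * (h j : ℕ)))

omit hθ in
theorem prod_map_sovList (ξ : Fin N → ℂ) (h : Spins N) (f : ℂ → ℂ) :
    ((sovList η ξ h h).map f).prod = ∏ n, f (ξ n - η * (1 - (h n : ℕ))) := by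
  rw [sovList, List.map_append, List.prod_append, prod_map_multiList, prod_map_multiList,
    List.prod_ofFn, List.prod_ofFn, ← Finset.prod_mul_distrib]
  refine Finset.prod_congr rfl fun n _ => ?_
  generalize h n = a
  fin_cases a <;> simp

theorem chain_sov_self {ξ : Fin N → ℂ} (hg : Generic θ η ξ) {t : ℂ} (ht : Regular θ η t)
    (h : Spins N) :
    chain θ κ η ξ (sovList η ξ h h) t 0 1
      = (-1) ^ N * (∏ n, ∏ m, θ (ξ n - ξ m - η))
        * (twist θ κ (t + N * η) / twist θ κ (t + (∑ n, (h n : ℕ) : ℕ) * η))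
        * pairRatio θ η ξ h := by
  induction N generalizing t with
  | zero =>
    simp [sovList, multiList, chain, pairRatio, Subsingleton.elim (0 : Spins 0) 1,
      ht.twist_ne_zero κ]
  | succ N ih =>
    have ht1 : twist θ κ (t + (N + 1) * η) ≠ 0 := by
      simpa using (ht.shift (N + 1)).twist_ne_zero κ
    have ht2 : twist θ κ (t + N * η) ≠ 0 := by simpa using (ht.shift N).twist_ne_zero κ
    have hm : ∀ x ∈ sovList η (Fin.tail ξ) (Fin.tail h) (Fin.tail h),
        ∃ n, n ≠ 0 ∧ (x = ξ n ∨ x = ξ n - η) := fun x hx => by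
      rcases List.mem_append.1 hx with hx | hx
      · obtain ⟨n, rfl⟩ := mem_multiList hx
        exact ⟨n.succ, Fin.succ_ne_zero n, .inl rfl⟩
      · obtain ⟨n, rfl⟩ := mem_multiList hx
        exact ⟨n.succ, Fin.succ_ne_zero n, .inr rfl⟩
    -- The diagonal factor `θ(-η) = -θ(η)` of each site is the source of `(-1) ^ N`.
    have hE : ∏ n, ∏ m, θ (ξ n - ξ m - η) = -θ η * (∏ n : Fin N, θ (ξ 0 - ξ n.succ - η) *
        θ (ξ n.succ - ξ 0 - η)) * ∏ n, ∏ m, θ (Fin.tail ξ n - Fin.tail ξ m - η) := by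
      simp only [Fin.prod_univ_succ, Finset.prod_mul_distrib, sub_self, zero_sub, hθ.odd, Fin.tail]
      ring
    have hP : pairRatio θ η ξ h = (∏ n : Fin N, θ (ξ 0 - ξ n.succ) /
        θ (ξ 0 - η * (h 0 : ℕ) - (ξ n.succ - η * (h n.succ : ℕ)))) *
        pairRatio θ η (Fin.tail ξ) (Fin.tail h) := by
      rw [pairRatio, Fin.prod_univ_succ]
      simp only [Fin.prod_Ioi_zero, Fin.prod_Ioi_succ]
      rfl
    have hS : ((∑ n, (h n : ℕ) : ℕ) : ℂ) = (h 0 : ℕ) + ((∑ n, (Fin.tail h n : ℕ) : ℕ) : ℂ) := by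
      rw [Fin.sum_univ_succ, Nat.cast_add]
      rfl
    have hn0 : ∀ n : Fin N, (0 : Fin (N + 1)) ≠ n.succ := fun n => (Fin.succ_ne_zero n).symm
    have h01 : h 0 = 0 ∨ h 0 = 1 := by
      generalize h 0 = a
      revert a
      decide
    rcases h01 with h0 | h0
    · have el : sovList η ξ h h = multiList (Fin.tail ξ) (fun n => (Fin.tail h n : ℕ)) ++
          (ξ 0 - η) :: multiList (fun n => Fin.tail ξ n - η) (fun n => 1 - (Fin.tail h n : ℕ)) := by
        rw [sovList, multiList_succ, multiList_succ, h0]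
        rfl
      rw [el, chain_freeze_down hθ hg ht (length_sovList_self _ _)
        fun x hx => hm x (List.mem_append_left _ hx)]
      change _ * chain θ κ η (Fin.tail ξ) (sovList η (Fin.tail ξ) (Fin.tail h) (Fin.tail h)) t 0 1
        = _
      rw [ih hg.tail ht]
      change _ * ((sovList η (Fin.tail ξ) (Fin.tail h) (Fin.tail h)).map _).prod * _ * _ = _
      have K : (∏ n, θ (ξ 0 - Fin.tail ξ n - η))
          * ∏ n, θ (Fin.tail ξ n - η * (1 - (Fin.tail h n : ℕ)) - ξ 0)
          = (∏ n : Fin N, θ (ξ 0 - ξ n.succ - η) * θ (ξ n.succ - ξ 0 - η)) *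
            ∏ n : Fin N, θ (ξ 0 - ξ n.succ) /
              θ (ξ 0 - η * ((0 : Fin 2) : ℕ) - (ξ n.succ - η * (h n.succ : ℕ))) := by
        simp only [← Finset.prod_mul_distrib, Fin.tail]
        refine Finset.prod_congr rfl fun n _ => ?_
        generalize h n.succ = a
        have h1 := hg.zero _ _ (hn0 n)
        have h2 := hg.add _ _ (hn0 n)
        rw [show ξ n.succ - ξ 0 - η = -(ξ 0 - ξ n.succ + η) by ring, hθ.odd]
        fin_cases a
        · simp only [Fin.val_zero, Nat.cast_zero, mul_zero, sub_zero, mul_one]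
          rw [show ξ n.succ - η - ξ 0 = -(ξ 0 - ξ n.succ + η) by ring, hθ.odd]
          field_simp
        · simp only [Nat.cast_one, sub_self, mul_zero, sub_zero, mul_one,
            Fin.val_zero, Nat.cast_zero]
          rw [show ξ 0 - (ξ n.succ - η) = ξ 0 - ξ n.succ + η by ring,
            show ξ n.succ - ξ 0 = -(ξ 0 - ξ n.succ) by ring, hθ.odd]
          field_simp
      rw [prod_map_sovList, mul_assoc (θ η), K, hE, hP, hS, h0, Fin.val_zero, Nat.cast_zero,
        zero_add, Nat.cast_add, Nat.cast_one]
      generalize twist θ κ (t + N * η) = w at ht2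
      field_simp
      ring
    · have el : sovList η ξ h h = ξ 0 :: sovList η (Fin.tail ξ) (Fin.tail h) (Fin.tail h) := by
        rw [sovList, multiList_succ, multiList_succ, h0]
        rfl
      rw [el, chain_freeze_up hθ hg ht hm, ih hg.tail ht.add, prod_map_sovList]
      have K : (∏ n, θ (ξ 0 - Fin.tail ξ n + η))
          * ∏ n, θ (Fin.tail ξ n - η * (1 - (Fin.tail h n : ℕ)) - ξ 0 + η)
          = (∏ n : Fin N, θ (ξ 0 - ξ n.succ - η) * θ (ξ n.succ - ξ 0 - η)) *
            ∏ n : Fin N, θ (ξ 0 - ξ n.succ) /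
              θ (ξ 0 - η * ((1 : Fin 2) : ℕ) - (ξ n.succ - η * (h n.succ : ℕ))) := by
        simp only [← Finset.prod_mul_distrib, Fin.tail]
        refine Finset.prod_congr rfl fun n _ => ?_
        generalize h n.succ = a
        have h1 := hg.zero _ _ (hn0 n)
        have h2 := hg.sub _ _ (hn0 n)
        rw [show ξ n.succ - ξ 0 - η = -(ξ 0 - ξ n.succ + η) by ring, hθ.odd]
        fin_cases a
        · simp only [Nat.cast_zero, mul_zero, sub_zero, mul_one,
            Fin.val_one, Nat.cast_one]
          rw [show ξ n.succ - η - ξ 0 + η = -(ξ 0 - ξ n.succ) by ring, hθ.odd,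
            sub_right_comm (ξ 0) η]
          field_simp
        · simp only [Fin.val_one, Nat.cast_one, sub_self, mul_zero, sub_zero, mul_one]
          rw [sub_sub_sub_cancel_right,
            show ξ n.succ - ξ 0 + η = -(ξ 0 - ξ n.succ - η) by ring, hθ.odd]
          field_simp
      rw [mul_assoc (θ η), K, hE, hP, hS, h0, Fin.val_one, Nat.cast_one, Nat.cast_add, Nat.cast_one,
        show t + η + N * η = t + (N + 1) * η by ring, add_mul 1, one_mul, ← add_assoc]
      ring

end Sov

/-! ### The model in terms of the twisted theta function -/

theorem prod_ofFn_smul_pow {N : ℕ} (s : Fin N → ℂ) (ζ : Fin N → ℂ) (k : Fin N → ℕ)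
    {A : Type*} [Ring A] [Algebra ℂ A] (f : ℂ → A) :
    (List.ofFn fun n => (s n • f (ζ n)) ^ k n).prod
      = (∏ n, s n ^ k n) • ((multiList ζ k).map f).prod := by
  rw [prod_map_multiList]
  induction N with
  | zero => simp
  | succ N ih =>
    rw [List.ofFn_succ, List.prod_cons, ih (fun n => s n.succ) (fun n => ζ n.succ),
      List.ofFn_succ, List.prod_cons, Fin.prod_univ_succ, smul_pow, smul_mul_smul_comm]

namespace Params

variable {N : ℕ} (p : Params N)

/-- The exponent of the twist that absorbs the phases of the `R`-matrix. -/
def kappa : ℂ := I * p.y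

/-- The phases are ratios of exponentials at `t ± s` and `t`; oddness turns the weights at `-t` into
ratios at `t - s`. -/
theorem R_eq_dynR (hodd : ∀ z, theta p.ω (-z) = -theta p.ω z) (l t : ℂ) :
    p.R l t = dynR (theta p.ω) p.kappa p.η l t := by
  have e : ∀ s, twist (theta p.ω) p.kappa (t + s) / twist (theta p.ω) p.kappa t
      = exp (p.kappa * s) * (theta p.ω (t + s) / theta p.ω t) := fun s => by
    rw [twist, twist, mul_add, Complex.exp_add, mul_assoc, mul_div_mul_left _ _ (exp_ne_zero _),
      mul_div_assoc]
  have e' : ∀ s, twist (theta p.ω) p.kappa (t - s) / twist (theta p.ω) p.kappa t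
      = exp (-(p.kappa * s)) * (theta p.ω (-t + s) / theta p.ω (-t)) := fun s => by
    rw [sub_eq_add_neg, e, hodd t, show -t + s = -(t + -s) by ring, hodd, neg_div_neg_eq, mul_neg]
  ext ⟨a, b⟩ ⟨c, d⟩
  fin_cases a <;> fin_cases b <;> fin_cases c <;> fin_cases d <;>
    simp only [Params.R, dynR, mul_div_assoc, e, e', wa, wb, wc, Fin.zero_eta, Fin.mk_one] <;>
    simp only [kappa, neg_mul] <;> ring

/-- The model without its first site. -/
def tail (p : Params (N + 1)) : Params N := { p with ξ := Fin.tail p.ξ }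

/-- The operators that preserve the first spin, as families of operators on the other spins. -/
def firstSpinDiagonal (N : ℕ) : (Fin 2 → Matrix (Fin 2 × Spins N) (Fin 2 × Spins N) ℂ) →*
    Matrix (Fin 2 × Spins (N + 1)) (Fin 2 × Spins (N + 1)) ℂ where
  toFun f := Matrix.of fun i j =>
    if i.2 0 = j.2 0 then f (j.2 0) (i.1, Fin.tail i.2) (j.1, Fin.tail j.2) else 0
  map_one' := by
    ext ⟨i, h'⟩ ⟨j, h⟩
    have : h' = h ↔ h' 0 = h 0 ∧ Fin.tail h' = Fin.tail h := by
      rw [funext_iff, Fin.forall_fin_succ, funext_iff]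
      rfl
    simp only [Matrix.of_apply, Pi.one_apply, Matrix.one_apply, Prod.mk.injEq, this]
    split_ifs <;> tauto
  map_mul' f g := by
    ext ⟨i, h'⟩ ⟨j, h⟩
    simp only [Matrix.of_apply, Matrix.mul_apply, Fintype.sum_prod_type, sum_spins_succ,
      Fin.cons_zero, Fin.tail_cons, Pi.mul_apply]
    by_cases e : h' 0 = h 0
    · rw [if_pos e]
      refine Finset.sum_congr rfl fun s _ => ?_
      rw [Finset.sum_eq_single (h 0)]
      · simp [e]
      · intro a _ ha
        simp [ha]
      · simp
    · rw [if_neg e]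
      symm
      refine Finset.sum_eq_zero fun s _ => Finset.sum_eq_zero fun a _ =>
        Finset.sum_eq_zero fun k _ => ?_
      by_cases ea : h' 0 = a
      · rw [if_neg (c := a = h 0) (by rwa [← ea]), mul_zero]
      · rw [if_neg ea, zero_mul]

theorem site_succ (p : Params (N + 1)) (l t : ℂ) (n : Fin N) :
    p.site l t n.succ = firstSpinDiagonal N fun a => p.tail.site l (t + p.η * sz a) n := by
  ext ⟨i, h'⟩ ⟨j, h⟩
  simp only [site, firstSpinDiagonal, MonoidHom.coe_mk, OneHom.coe_mk, Matrix.of_apply]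
  have e1 : (∀ m, m ≠ n.succ → h' m = h m) ↔
      h' 0 = h 0 ∧ ∀ m, m ≠ n → Fin.tail h' m = Fin.tail h m := by
    rw [Fin.forall_fin_succ]
    simp [Fin.tail, (Fin.succ_ne_zero n).symm]
  have e2 : ∑ a ∈ Finset.univ.filter (· < n.succ), sz (h a)
      = sz (h 0) + ∑ a ∈ Finset.univ.filter (· < n), sz (Fin.tail h a) := by
    simp [Finset.sum_filter, Fin.sum_univ_succ, Fin.tail]
  simp only [e1, e2, ite_and, mul_add, ← add_assoc]
  rfl

/-- The first site acts first on kets. The later sites preserve the first spin and feel it only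
through the shift of `t`, so they use its outgoing value, as `rowMat` does. -/
theorem monodromy_succ (p : Params (N + 1)) (l t : ℂ) :
    p.monodromy l t
      = firstSpinDiagonal N (fun a => p.tail.monodromy l (t + p.η * sz a)) * p.site l t 0 := by
  have : (fun a => p.tail.monodromy l (t + p.η * sz a))
      = (List.ofFn fun n a => p.tail.site l (t + p.η * sz a) n).reverse.prod := by
    funext a
    have := map_list_prod (Pi.evalMonoidHom
      (fun _ : Fin 2 => Matrix (Fin 2 × Spins N) (Fin 2 × Spins N) ℂ) a)
      (List.ofFn fun n a => p.tail.site l (t + p.η * sz a) n).reverse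
    rw [Pi.evalMonoidHom_apply] at this
    rw [this, List.map_reverse, List.map_ofFn]
    rfl
  rw [this, map_list_prod, List.map_reverse, List.map_ofFn, monodromy, List.ofFn_succ,
    List.reverse_cons, List.prod_append, List.prod_singleton]
  simp only [site_succ]
  rfl

theorem monodromy_apply (hodd : ∀ z, theta p.ω (-z) = -theta p.ω z) (l t : ℂ) (i j : Fin 2)
    (h' h : Spins N) :
    p.monodromy l t (i, h') (j, h)
      = rowMat (theta p.ω) p.kappa p.η N p.ξ l t h' h i j := by
  induction N generalizing t j with
  | zero =>
    simp [monodromy, rowMat, Matrix.one_apply, Subsingleton.elim h' h]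
  | succ N ih =>
    rw [monodromy_succ, Matrix.mul_apply, Fintype.sum_prod_type, rowMat, Matrix.mul_apply]
    refine Finset.sum_congr rfl fun s _ => ?_
    have e : ∀ k : Spins (N + 1),
        (∀ m, m ≠ 0 → k m = h m) ↔ Fin.tail k = Fin.tail h := fun k => by
      rw [Fin.forall_fin_succ, funext_iff]
      simp [Fin.tail]
    rw [sum_spins_succ, Finset.sum_eq_single (h' 0), Finset.sum_eq_single (Fin.tail h)]
    · simp only [firstSpinDiagonal, MonoidHom.coe_mk, OneHom.coe_mk, Matrix.of_apply,
        Fin.cons_zero, Fin.tail_cons, if_true, site, e, siteMat]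
      rw [ih p.tail hodd, R_eq_dynR p hodd]
      simp only [Finset.filter_false, Finset.sum_empty, mul_zero, add_zero, Fin.not_lt_zero]
      rfl
    · intro k _ hk
      rw [site, if_neg, mul_zero]
      rw [e, Fin.tail_cons]
      exact hk
    · simp
    · intro a _ ha
      refine Finset.sum_eq_zero fun k _ => ?_
      simp only [firstSpinDiagonal, MonoidHom.coe_mk, OneHom.coe_mk, Matrix.of_apply,
        Fin.cons_zero, if_neg ha.symm, zero_mul]
    · simp

theorem basisBra_basisKet (h' h : Spins N) (a' a : ℤ) :
    basisBra h' a' (basisKet h a) = if h = h' ∧ a = a' then 1 else 0 := by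
  simp [basisBra, basisKet, Finsupp.single_apply]

theorem calC_basisKet (l : ℂ) (h : Spins N) (a : ℤ) :
    p.calC l (basisKet h a)
      = ∑ k, p.monodromy l (p.t (a + 1)) (1, k) (0, h) • basisKet k (a + 1) := by
  simp [calC, calM, shift, monodromyTau, basisKet]

theorem ket_ext {φ ψ : Bra N} (h : ∀ k a, φ (basisKet k a) = ψ (basisKet k a)) : φ = ψ :=
  Finsupp.lhom_ext' fun s => LinearMap.ext_ring (h s.1 s.2)

variable (hodd : ∀ z, theta p.ω (-z) = -theta p.ω z)
include hodd

/-- On covectors `T_τ^+` lowers the label, and `t(a - 1) = t(a) + η`: this is the growth of the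
parameter along `chain`. -/
theorem basisBra_comp_calC (l : ℂ) (h' : Spins N) (a : ℤ) :
    (basisBra h' a).comp (p.calC l)
      = ∑ k, cMat (theta p.ω) p.kappa p.η p.ξ l (p.t a) h' k • basisBra k (a - 1) := by
  refine ket_ext fun h b => ?_
  simp only [LinearMap.comp_apply, calC_basisKet, map_sum, map_smul, basisBra_basisKet,
    LinearMap.sum_apply, LinearMap.smul_apply, smul_eq_mul, monodromy_apply p hodd, cMat,
    Matrix.of_apply, ite_and, mul_ite, mul_one, mul_zero, Finset.sum_ite_eq, Finset.mem_univ,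
    Finset.sum_ite_eq', if_true, eq_sub_iff_add_eq]
  by_cases e : b + 1 = a
  · simp [e]
  · simp [e]

theorem basisBra_comp_prod (ls : List ℂ) (h' : Spins N) (a : ℤ) :
    (basisBra h' a).comp (ls.map p.calC).prod
      = ∑ k, chain (theta p.ω) p.kappa p.η p.ξ ls (p.t a) h' k • basisBra k (a - ls.length) := by
  induction ls generalizing h' a with
  | nil =>
    simp [chain, Matrix.one_apply, Module.End.one_eq_id]
  | cons l ls ih =>
    have ht : p.t (a - 1) = p.t a + p.η := by
      simp only [t]
      push_cast
      ring
    have hs : ∀ (F : Spins N → ℂ) (X : Module.End ℂ (Ket N)),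
        (∑ k, F k • basisBra k (a - 1)).comp X = ∑ k, F k • (basisBra k (a - 1)).comp X :=
      fun F X => LinearMap.ext fun v => by simp [LinearMap.sum_apply]
    rw [List.map_cons, List.prod_cons, Module.End.mul_eq_comp, ← LinearMap.comp_assoc,
      basisBra_comp_calC p hodd, hs]
    simp only [ih, ht, chain, Matrix.mul_apply, Finset.sum_smul,
      Finset.smul_sum, smul_smul, List.length_cons]
    rw [Finset.sum_comm]
    refine Finset.sum_congr rfl fun k _ => Finset.sum_congr rfl fun m _ => ?_
    push_cast
    rw [sub_sub, add_comm (1 : ℤ)]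

/-- The matrix elements between the left and right SOV states, before normalization. -/
theorem sovBra_sovKet (c : ℂ) (r r' : ℤ) (h h' : Spins N) :
    p.sovBra c r h (p.sovKet c r' h')
      = if r' + N = r + (sovList p.η p.ξ h h').length then
          c⁻¹ ^ 2 * ((∏ n, (p.funD (p.ξ n - p.η))⁻¹ ^ (h n : ℕ))
            * ∏ n, (p.funD (p.ξ n - p.η))⁻¹ ^ (1 - (h' n : ℕ)))
          * chain (theta p.ω) p.kappa p.η p.ξ (sovList p.η p.ξ h h') (p.trh r 0) 0 1
        else 0 := by
  have hb := congrArg (fun φ : Bra N => φ (basisKet 1 (dynLabel r' (1 : Spins N))))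
    (basisBra_comp_prod p hodd (sovList p.η p.ξ h h') 0 (dynLabel r (0 : Spins N)))
  -- The end labels are `-r'-N` and `-r`, and each factor `𝓒` lowers the label by one.
  have hd : dynLabel r' (1 : Spins N) = dynLabel r (0 : Spins N) - (sovList p.η p.ξ h h').length
      ↔ r' + N = r + (sovList p.η p.ξ h h').length := by
    simp only [dynLabel, Pi.one_apply, Pi.zero_apply, Fin.val_one, Fin.val_zero, Nat.cast_one,
      Nat.cast_zero, Finset.sum_const, Finset.card_univ, Fintype.card_fin, nsmul_eq_mul, mul_one,
      mul_zero]
    constructor <;> intro e <;> linarith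
  simp only [LinearMap.sum_apply, LinearMap.smul_apply, basisBra_basisKet, smul_eq_mul, ite_and,
    mul_ite, mul_one, mul_zero, Finset.sum_ite_eq, Finset.mem_univ, if_true, hd, p.t_dynLabel] at hb
  have hm : ((sovList p.η p.ξ h h').map p.calC).prod
      = ((multiList p.ξ fun n => (h n : ℕ)).map p.calC).prod
        * ((multiList (fun n => p.ξ n - p.η) fun n => 1 - (h' n : ℕ)).map p.calC).prod := by
    rw [sovList, List.map_append, List.prod_append]
  rw [hm, LinearMap.comp_apply, Module.End.mul_apply] at hb
  rw [sovBra, sovKet, prod_ofFn_smul_pow _ p.ξ _ p.calC,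
    prod_ofFn_smul_pow _ (fun n => p.ξ n - p.η) _ p.calC, refBra, refKet]
  simp only [LinearMap.comp_apply, LinearMap.smul_apply, map_smul, smul_eq_mul, hb]
  split_ifs with e
  · ring
  · simp

omit hodd in
theorem trh_add (r : ℤ) (h : Spins N) :
    p.trh r 0 + ((∑ n, (h n : ℕ) : ℕ) : ℂ) * p.η = p.trh r h := by
  simp only [trh, sz, Finset.sum_sub_distrib, ← Finset.mul_sum]
  push_cast
  simp
  ring

omit hodd in
theorem trh_one (r : ℤ) : p.trh r 0 + N * p.η = p.trh r (1 : Spins N) := by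
  simpa using p.trh_add r 1

theorem sov_pairing (hθ : ThreeTerm (theta p.ω)) (hg : Generic (theta p.ω) p.η p.ξ)
    (ht : ∀ a, theta p.ω (p.t a) ≠ 0) (c : ℂ) (r r' : ℤ) (h h' : Spins N) :
    p.sovBra c r h (p.sovKet c r' h')
      = if r = r' ∧ h = h' then
          c⁻¹ ^ 2 * (-1) ^ N * (twist (theta p.ω) p.kappa (p.trh r 1)
            / twist (theta p.ω) p.kappa (p.trh r h)) * pairRatio (theta p.ω) p.η p.ξ h
        else 0 := by
  have hreg : Regular (theta p.ω) p.η (p.trh r 0) := fun k => by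
    have := ht (-r - k)
    convert this using 2
    simp only [trh, t, t0, sz]
    push_cast
    simp
    ring
  rw [sovBra_sovKet p hodd]
  by_cases e : h = h'
  swap
  · rw [chain_sov_off hθ hg hreg e]
    simp [e]
  subst e
  rw [length_sovList_self]
  by_cases er : r = r'
  swap
  · rw [if_neg, if_neg]
    · simp [er]
    · intro h
      exact er (by linarith)
  subst er
  rw [if_pos rfl, if_pos ⟨rfl, rfl⟩, chain_sov_self hθ hg hreg, trh_one, trh_add,
    ← Finset.prod_mul_distrib]
  -- When `h = h'` each site contributes exactly one factor `1/𝖽(ξ_n - η)`; together they cancel the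
  -- double product in `chain_sov_self`.
  have hd : ∀ n, p.funD (p.ξ n - p.η) = ∏ m, theta p.ω (p.ξ n - p.ξ m - p.η) := fun n => by
    simp only [funD, funA, wa]
    refine Finset.prod_congr rfl fun m _ => ?_
    congr 1
    ring
  have hs : ∀ n, (p.funD (p.ξ n - p.η))⁻¹ ^ (h n : ℕ) * (p.funD (p.ξ n - p.η))⁻¹ ^ (1 - (h n : ℕ))
      = (∏ m, theta p.ω (p.ξ n - p.ξ m - p.η))⁻¹ := fun n => by
    rw [← pow_add, show (h n : ℕ) + (1 - (h n : ℕ)) = 1 by omega, pow_one, hd]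
  simp only [hs, Finset.prod_inv_distrib]
  have hne : ∏ n, ∏ m, theta p.ω (p.ξ n - p.ξ m - p.η) ≠ 0 := by
    refine Finset.prod_ne_zero_iff.2 fun n _ => Finset.prod_ne_zero_iff.2 fun m _ => ?_
    by_cases e : n = m
    · rw [e, sub_self, zero_sub, hodd, neg_ne_zero]
      exact hg.eta
    · exact hg.sub n m e
  field_simp

end Params

/-! ### Fourier coefficients of periodic entire functions -/

/-- The Fourier coefficients of a `π`-periodic function. -/
def fcoeff (h : ℂ → ℂ) (k : ℤ) : ℂ := ∫ x in (0 : ℝ)..π, h x * exp (-2 * I * k * x)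

theorem exp_int_pi (k : ℤ) : exp (-2 * I * k * π) = 1 := by
  rw [show -2 * I * k * π = ((-k : ℤ) : ℂ) * (2 * π * I) by push_cast; ring]
  exact exp_int_mul_two_pi_mul_I _

/-- Cauchy's theorem on a rectangle of width `π`: periodicity cancels the vertical sides. -/
theorem integral_shift {F : ℂ → ℂ} (hF : Differentiable ℂ F) (hp : ∀ z, F (z + π) = F z) (w : ℂ) :
    ∫ x in (0 : ℝ)..π, F (x + w) = ∫ x in (0 : ℝ)..π, F x := by
  have hr := integral_boundary_rect_eq_zero_of_differentiableOn F (w.re : ℂ)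
    ((w.re + π : ℝ) + w.im * I) hF.differentiableOn
  have e : ∀ y : ℝ, F ((w.re + π : ℝ) + y * I) = F (w.re + y * I) := fun y => by
    rw [← hp (w.re + y * I)]
    push_cast
    ring_nf
  simp only [ofReal_re, ofReal_im, add_re, mul_re, I_re, mul_zero, I_im, mul_one,
    add_im, mul_im, add_zero, zero_add, ofReal_zero, zero_mul, e, sub_self] at hr
  have h1 : ∫ x in w.re..w.re + π, F x = ∫ x in (0 : ℝ)..0 + π, F x :=
    Function.Periodic.intervalIntegral_add_eq (f := fun x : ℝ => F x)
      (fun x => by simpa using hp x) _ _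
  have h2 : ∫ x in (0 : ℝ)..π, F (x + w) = ∫ x in w.re..w.re + π, F (x + w.im * I) := by
    have := intervalIntegral.integral_comp_add_right (a := 0) (b := π)
      (fun x : ℝ => F (x + w.im * I)) w.re
    rw [zero_add, add_comm π] at this
    rw [← this]
    refine intervalIntegral.integral_congr fun x _ => ?_
    simp only [ofReal_add]
    rw [add_assoc, re_add_im]
  have h3 : ∫ x in w.re..w.re + π, F x = ∫ x in w.re..w.re + π, F (x + w.im * I) := by
    linear_combination hr
  rw [h2, ← h3, h1, zero_add]

theorem fcoeff_shift {h : ℂ → ℂ} (hd : Differentiable ℂ h) (hp : ∀ z, h (z + π) = h z) (k : ℤ)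
    (w : ℂ) : fcoeff (fun z => h (z + w)) k = exp (2 * I * k * w) * fcoeff h k := by
  have := integral_shift (F := fun z => h z * exp (-2 * I * k * z)) (by fun_prop)
    (fun z => by simp only [hp, mul_add, Complex.exp_add, exp_int_pi, mul_one]) w
  unfold fcoeff
  rw [← this, ← intervalIntegral.integral_const_mul]
  refine intervalIntegral.integral_congr fun x _ => ?_
  simp only [mul_add, Complex.exp_add]
  have e : exp (2 * I * k * w) * exp (-2 * I * k * w) = 1 := by
    rw [← Complex.exp_add]
    simp
  linear_combination -h (x + w) * exp (-2 * I * k * x) * e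

/-- The Fourier series gives the value at `0`; translating the function by `w` reaches every complex
point. -/
theorem eq_zero_of_fcoeff {h : ℂ → ℂ} (hd : Differentiable ℂ h) (hp : ∀ z, h (z + π) = h z)
    (h0 : ∀ k, fcoeff h k = 0) : h = 0 := by
  have key : ∀ g : ℂ → ℂ, Differentiable ℂ g → (∀ z, g (z + π) = g z) → (∀ k, fcoeff g k = 0) →
      g 0 = 0 := by
    intro g hg hgp hg0
    have : Fact (0 < π) := ⟨Real.pi_pos⟩
    have per : Function.Periodic (fun x : ℝ => g x) π := fun x => by simpa using hgp x
    have hc : Continuous per.lift := by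
      have : Continuous fun x : ℝ => g x := hg.continuous.comp continuous_ofReal
      exact continuous_coinduced_dom.2 this
    have hz : fourierCoeff (per.lift : AddCircle π → ℂ) = 0 := by
      funext n
      rw [fourierCoeff_eq_intervalIntegral _ n 0, zero_add]
      have : ∫ x in (0 : ℝ)..π, fourier (-n) (x : AddCircle π) • per.lift (x : AddCircle π)
          = fcoeff g n := by
        refine intervalIntegral.integral_congr fun x _ => ?_
        simp only [fourier_coe_apply, Function.Periodic.lift_coe, smul_eq_mul]
        rw [mul_comm]
        congr 2
        have : (π : ℂ) ≠ 0 := ofReal_ne_zero.2 Real.pi_ne_zero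
        push_cast
        field_simp
      rw [this, hg0, smul_zero]
      rfl
    let G : C(AddCircle π, ℂ) := ⟨per.lift, hc⟩
    have hz' : fourierCoeff G = 0 := hz
    have hs := has_pointwise_sum_fourier_series_of_summable (f := G)
      (by rw [hz']; exact summable_zero) ((0 : ℝ) : AddCircle π)
    rw [hz'] at hs
    simp only [Pi.zero_apply, zero_smul] at hs
    have : per.lift ((0 : ℝ) : AddCircle π) = 0 := hs.unique hasSum_zero
    rw [Function.Periodic.lift_coe] at this
    simpa using this
  funext w
  have := key (fun z => h (z + w)) (by fun_prop) (fun z => by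
    rw [show z + π + w = z + w + π by ring, hp]) fun k => by
    rw [fcoeff_shift hd hp, h0, mul_zero]
  simpa using this

/-- Some Fourier coefficient is nonzero, and the shift by `πω` multiplies the `k`-th one both by `c`
and by `e^{2ikπω}`. -/
theorem eq_exp_of_quasiperiodic {ω : ℂ} {h : ℂ → ℂ} {c : ℂ}
    (hd : Differentiable ℂ h) (hp : ∀ z, h (z + π) = h z) (hq : ∀ z, h (z + π * ω) = c * h z)
    (hne : h ≠ 0) : ∃ k : ℤ, c = exp (2 * I * k * (π * ω)) := by
  by_contra! hc
  refine hne (eq_zero_of_fcoeff hd hp fun k => ?_)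
  have h1 := fcoeff_shift hd hp k (π * ω)
  have h2 : fcoeff (fun z => h (z + π * ω)) k = c * fcoeff h k := by
    simp only [hq, fcoeff, mul_assoc, intervalIntegral.integral_const_mul]
  rw [h2] at h1
  have : (c - exp (2 * I * k * (π * ω))) * fcoeff h k = 0 := by linear_combination h1
  exact (mul_eq_zero.1 this).resolve_left (sub_ne_zero.2 (hc k))

/-! ### The space of theta functions of order `N` and norm `0` -/

/-- Theta functions of order `N` and norm `0`. -/
def thetaSpace (ω : ℂ) (N : ℕ) : Submodule ℂ (ℂ → ℂ) where
  carrier := {f | IsThetaFunction ω N 0 f}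
  add_mem' := by
    rintro f g ⟨hf, hf1, hf2⟩ ⟨hg, hg1, hg2⟩
    refine ⟨hf.add hg, fun z => ?_, fun z => ?_⟩
    · simp only [Pi.add_apply, hf1, hg1]; ring
    · simp only [Pi.add_apply, hf2, hg2]; ring
  zero_mem' := ⟨differentiable_const 0, by simp, by simp⟩
  smul_mem' := by
    rintro c f ⟨hf, hf1, hf2⟩
    refine ⟨hf.const_smul c, fun z => ?_, fun z => ?_⟩
    · simp only [Pi.smul_apply, hf1, smul_eq_mul]; ring
    · simp only [Pi.smul_apply, hf2, smul_eq_mul]; ring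

theorem exp_nat_pi (N : ℕ) : exp (I * N * π) = (-1) ^ N := by
  rw [show I * N * π = N * (π * I) by ring, Complex.exp_nat_mul, exp_pi_mul_I]

/-- The factor `e^{iNz}` absorbs the sign `(-1)^N` and makes the function `π`-periodic; the second
quasi-period then links coefficients `N` apart, so `N` consecutive ones determine the function. -/
theorem fcoeff_theta {ω : ℂ} {N : ℕ} {f : ℂ → ℂ} (hf : IsThetaFunction ω N 0 f) (k : ℤ) :
    exp (2 * I * k * (π * ω)) * fcoeff (fun z => f z * exp (I * N * z)) k
      = (-1) ^ N * fcoeff (fun z => f z * exp (I * N * z)) (k + N) := by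
  obtain ⟨hd, h1, h2⟩ := hf
  have s : ((-1 : ℂ) ^ N) * (-1) ^ N = 1 := by rw [← mul_pow]; simp
  rw [← fcoeff_shift (h := fun z => f z * exp (I * N * z)) (by fun_prop) fun z => by
    rw [h1, mul_add, Complex.exp_add, exp_nat_pi]
    linear_combination f z * exp (I * N * z) * s]
  unfold fcoeff
  rw [← intervalIntegral.integral_const_mul]
  refine intervalIntegral.integral_congr fun x _ => ?_
  simp only [h2, mul_zero, Complex.exp_zero, mul_one]
  have e : exp (-I * N * (2 * x + π * ω)) * exp (I * N * (x + π * ω)) * exp (-2 * I * k * x)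
      = exp (I * N * x) * exp (-2 * I * ((k + N : ℤ) : ℂ) * x) := by
    simp only [← Complex.exp_add]
    congr 1
    push_cast
    ring
  linear_combination (-1) ^ N * f x * e

theorem eq_zero_of_fcoeff_theta {ω : ℂ} {N : ℕ} (hN : 1 ≤ N) {f : ℂ → ℂ}
    (hf : IsThetaFunction ω N 0 f)
    (h0 : ∀ k : Fin N, fcoeff (fun z => f z * exp (I * N * z)) (k : ℕ) = 0) : f = 0 := by
  set F := fcoeff (fun z => f z * exp (I * N * z)) with hF
  have step : ∀ k, F k = 0 ↔ F (k + N) = 0 := fun k => by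
    have := fcoeff_theta hf k
    constructor
    · intro h
      rw [← hF, h, mul_zero] at this
      exact (mul_eq_zero.1 this.symm).resolve_left (pow_ne_zero _ (by norm_num))
    · intro h
      rw [← hF, h, mul_zero] at this
      exact (mul_eq_zero.1 this).resolve_left (exp_ne_zero _)
  have hm : ∀ (m : ℤ) (r : ℤ), F r = 0 → F (r + m * N) = 0 := by
    intro m r hr
    induction m using Int.induction_on with
    | zero => simpa using hr
    | succ m ih => rw [add_mul, one_mul, ← add_assoc]; exact (step _).1 ih
    | pred m ih =>
      rw [step]
      convert ih using 2
      ring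
  have hall : ∀ k, F k = 0 := fun k => by
    have hN' : (0 : ℤ) < N := by exact_mod_cast hN
    have h1 := Int.emod_nonneg k hN'.ne'
    have h2 := Int.emod_lt_of_pos k hN'
    have := hm (k / N) (k % N) (by
      have := h0 ⟨(k % N).toNat, by omega⟩
      simpa [Int.toNat_of_nonneg h1] using this)
    rwa [mul_comm, Int.emod_add_mul_ediv] at this
  obtain ⟨hd, h1, h2⟩ := hf
  have s : ((-1 : ℂ) ^ N) * (-1) ^ N = 1 := by rw [← mul_pow]; simp
  have := eq_zero_of_fcoeff (h := fun z => f z * exp (I * N * z)) (by fun_prop) (fun z => by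
    rw [h1, mul_add, Complex.exp_add, exp_nat_pi]
    linear_combination f z * exp (I * N * z) * s) hall
  funext z
  exact (mul_eq_zero.1 (congrFun this z)).resolve_right (exp_ne_zero _)

theorem intervalIntegrable_fcoeff {h : ℂ → ℂ} (hd : Differentiable ℂ h) (k : ℤ) :
    IntervalIntegrable (fun x : ℝ => h x * exp (-2 * I * k * x)) MeasureTheory.volume 0 π := by
  refine Continuous.intervalIntegrable ?_ _ _
  have := hd.continuous
  fun_prop

/-- The first `N` Fourier coefficients of a theta function of order `N`. -/
def thetaCoeff (ω : ℂ) (N : ℕ) : thetaSpace ω N →ₗ[ℂ] (Fin N → ℂ) where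
  toFun f k := fcoeff (fun z => f.1 z * exp (I * N * z)) (k : ℕ)
  map_add' f g := by
    funext k
    have hf : Differentiable ℂ fun z => f.1 z * exp (I * N * z) := f.2.1.mul (by fun_prop)
    have hg : Differentiable ℂ fun z => g.1 z * exp (I * N * z) := g.2.1.mul (by fun_prop)
    simp only [fcoeff, Pi.add_apply]
    rw [← intervalIntegral.integral_add (intervalIntegrable_fcoeff hf _)
      (intervalIntegrable_fcoeff hg _)]
    refine intervalIntegral.integral_congr fun x _ => ?_
    simp only [Submodule.coe_add, Pi.add_apply]
    ring
  map_smul' c f := by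
    funext k
    simp only [fcoeff, Pi.smul_apply, smul_eq_mul, RingHom.id_apply]
    rw [← intervalIntegral.integral_const_mul]
    refine intervalIntegral.integral_congr fun x _ => ?_
    simp only [Submodule.coe_smul, Pi.smul_apply, smul_eq_mul]
    ring

theorem thetaCoeff_injective (ω : ℂ) {N : ℕ} (hN : 1 ≤ N) :
    Function.Injective (thetaCoeff ω N) := by
  refine (injective_iff_map_eq_zero _).2 fun f hf => Subtype.ext ?_
  exact eq_zero_of_fcoeff_theta hN f.2 fun k => congrFun hf k

/-! ### The functions `ϑ_j` -/

/-- Integrating over `[0, 1]` keeps only the term `n = 0`, whose integral is `1`. -/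
theorem jacobiTheta₂_ne_zero {τ : ℂ} (hτ : 0 < τ.im) : ∃ z, jacobiTheta₂ z τ ≠ 0 := by
  by_contra! h0
  let f : ℤ → C(ℝ, ℂ) := fun n => ⟨fun x => jacobiTheta₂_term n x τ, by
    unfold jacobiTheta₂_term; fun_prop⟩
  have hs : Summable fun n : ℤ =>
      ‖(f n).restrict (⟨Set.uIcc (0 : ℝ) 1, isCompact_uIcc⟩ : TopologicalSpace.Compacts ℝ)‖ := by
    refine Summable.of_nonneg_of_le (fun n => norm_nonneg _) (fun n => ?_)
      ((summable_jacobiTheta₂_term_iff 0 τ).2 hτ).norm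
    refine (ContinuousMap.norm_le _ (norm_nonneg _)).2 fun x => le_of_eq ?_
    simp only [f, ContinuousMap.restrict_apply, ContinuousMap.coe_mk, norm_jacobiTheta₂_term,
      ofReal_im, zero_im]
  have h1 := intervalIntegral.hasSum_intervalIntegral_of_summable_norm hs
  have h2 : ∀ x : ℝ, ∑' n, f n x = 0 := fun x => h0 x
  simp only [h2, intervalIntegral.integral_zero] at h1
  have h3 : ∀ n ≠ 0, ∫ x in (0 : ℝ)..1, f n x = 0 := fun n hn => by
    have hc : 2 * π * I * n ≠ 0 := by
      simp [hn, Real.pi_ne_zero]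
    have e : ∀ x : ℝ, f n x = exp (π * I * n ^ 2 * τ) * exp (2 * π * I * n * x) := fun x => by
      simp only [f, ContinuousMap.coe_mk, jacobiTheta₂_term, Complex.exp_add]
      ring
    simp only [e, intervalIntegral.integral_const_mul]
    rw [integral_exp_mul_complex hc]
    have : exp (2 * π * I * n * (1 : ℝ)) = 1 := by
      rw [ofReal_one, mul_one, mul_comm]
      exact exp_int_mul_two_pi_mul_I n
    rw [this]
    simp
  have h4 : ∫ x in (0 : ℝ)..1, f 0 x = 1 := by
    simp [f, jacobiTheta₂_term]
  have h5 := (hasSum_single 0 h3).unique h1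
  rw [h4] at h5
  exact one_ne_zero h5

section Vartheta

variable {N : ℕ} {ω : ℂ}

theorem vartheta_eq (N : ℕ) (ω : ℂ) (j : ℕ) (z : ℂ) :
    vartheta N ω j z = exp (I * π * N * ω * (1 / 2 - j / N) ^ 2
        + 2 * I * N * (1 / 2 - j / N) * (z - π / 2))
      * jacobiTheta₂ (N * ω * (1 / 2 - j / N) + N * (z / π - 1 / 2)) (N * ω) := by
  have hp : (π : ℂ) ≠ 0 := ofReal_ne_zero.2 Real.pi_ne_zero
  rw [vartheta, jacobiTheta₂, ← tsum_mul_left]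
  refine tsum_congr fun n => ?_
  rw [jacobiTheta₂_term, ← Complex.exp_add]
  congr 1
  rw [show (n : ℂ) + 1 / 2 - j / N = n + (1 / 2 - j / N) by ring]
  generalize (1 / 2 - (j : ℂ) / N) = s
  field_simp
  ring

theorem im_nat_mul (hN : 1 ≤ N) (hω : 0 < ω.im) : 0 < (N * ω : ℂ).im := by
  have : (0 : ℝ) < N := by exact_mod_cast hN
  simpa using mul_pos this hω

/-- The terms of the series that defines `ϑ_j`. -/
def varthetaTerm (N : ℕ) (ω : ℂ) (j : ℕ) (z : ℂ) (n : ℤ) : ℂ :=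
  exp (I * π * N * ω * ((n : ℂ) + 1 / 2 - j / N) ^ 2
    + 2 * I * N * ((n : ℂ) + 1 / 2 - j / N) * (z - π / 2))

theorem summable_varthetaTerm (hN : 1 ≤ N) (hω : 0 < ω.im) (j : ℕ) (z : ℂ) :
    Summable (varthetaTerm N ω j z) := by
  have hp : (π : ℂ) ≠ 0 := ofReal_ne_zero.2 Real.pi_ne_zero
  have := ((summable_jacobiTheta₂_term_iff
    (N * ω * (1 / 2 - j / N) + N * (z / π - 1 / 2)) (N * ω)).2 (im_nat_mul hN hω)).mul_left
    (exp (I * π * N * ω * (1 / 2 - j / N) ^ 2 + 2 * I * N * (1 / 2 - j / N) * (z - π / 2)))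
  refine this.congr fun n => ?_
  rw [varthetaTerm, jacobiTheta₂_term, ← Complex.exp_add]
  congr 1
  rw [show (n : ℂ) + 1 / 2 - j / N = n + (1 / 2 - j / N) by ring]
  generalize (1 / 2 - (j : ℂ) / N) = s
  field_simp
  ring

theorem hasSum_varthetaTerm (hN : 1 ≤ N) (hω : 0 < ω.im) (j : ℕ) (z : ℂ) :
    HasSum (varthetaTerm N ω j z) (vartheta N ω j z) :=
  (summable_varthetaTerm hN hω j z).hasSum

theorem differentiable_vartheta (hN : 1 ≤ N) (hω : 0 < ω.im) (j : ℕ) :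
    Differentiable ℂ (vartheta N ω j) := by
  rw [funext (vartheta_eq N ω j)]
  have : Differentiable ℂ fun z => jacobiTheta₂ z (N * ω) := fun z =>
    differentiableAt_jacobiTheta₂_fst z (im_nat_mul hN hω)
  have := this.comp (f := fun z : ℂ => N * ω * (1 / 2 - j / N) + N * (z / π - 1 / 2)) (by fun_prop)
  exact Differentiable.mul (by fun_prop) this

theorem vartheta_add_pi_div (hN : 1 ≤ N) (ω : ℂ) (j : ℕ) (z : ℂ) :
    vartheta N ω j (z + π / N) = -exp (-2 * π * I * j / N) * vartheta N ω j z := by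
  have hN' : (N : ℂ) ≠ 0 := by exact_mod_cast (by omega : N ≠ 0)
  rw [vartheta, vartheta, ← tsum_mul_left]
  refine tsum_congr fun n => ?_
  have e : -exp (-2 * π * I * j / N) = exp (n * (2 * π * I) + π * I + -2 * π * I * j / N) := by
    rw [Complex.exp_add, Complex.exp_add, exp_int_mul_two_pi_mul_I, exp_pi_mul_I]
    ring
  rw [e, ← Complex.exp_add]
  congr 1
  field_simp
  ring

theorem vartheta_add_pi (hN : 1 ≤ N) (ω : ℂ) (j : ℕ) (z : ℂ) :
    vartheta N ω j (z + π) = (-1) ^ N * vartheta N ω j z := by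
  have hN' : (N : ℂ) ≠ 0 := by exact_mod_cast (by omega : N ≠ 0)
  rw [vartheta, vartheta, ← tsum_mul_left]
  refine tsum_congr fun n => ?_
  have e : (-1 : ℂ) ^ N = exp (((N * n - j : ℤ) : ℂ) * (2 * π * I) + I * N * π) := by
    rw [Complex.exp_add, exp_int_mul_two_pi_mul_I, exp_nat_pi, one_mul]
  rw [e, ← Complex.exp_add]
  congr 1
  push_cast
  field_simp
  ring

theorem vartheta_add_pi_mul (hN : 1 ≤ N) (ω : ℂ) (j : ℕ) (z : ℂ) :
    vartheta N ω j (z + π * ω) = (-1) ^ N * exp (-I * N * (2 * z + π * ω)) * vartheta N ω j z := by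
  have hN' : (N : ℂ) ≠ 0 := by exact_mod_cast (by omega : N ≠ 0)
  rw [vartheta, vartheta, ← tsum_mul_left, ← (Equiv.addRight (1 : ℤ)).tsum_eq (fun n : ℤ => _ * _)]
  refine tsum_congr fun n => ?_
  rw [← exp_nat_pi, ← Complex.exp_add, ← Complex.exp_add, Equiv.coe_addRight]
  congr 1
  push_cast
  field_simp
  ring

theorem isThetaFunction_vartheta (hN : 1 ≤ N) (hω : 0 < ω.im) (j : ℕ) :
    IsThetaFunction ω N 0 (vartheta N ω j) :=
  ⟨differentiable_vartheta hN hω j, vartheta_add_pi hN ω j, fun z => by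
    rw [vartheta_add_pi_mul hN, mul_zero, Complex.exp_zero, mul_one]⟩

theorem vartheta_ne_zero (hN : 1 ≤ N) (hω : 0 < ω.im) (j : ℕ) : vartheta N ω j ≠ 0 := by
  have hN' : (N : ℂ) ≠ 0 := by exact_mod_cast (by omega : N ≠ 0)
  have hp : (π : ℂ) ≠ 0 := ofReal_ne_zero.2 Real.pi_ne_zero
  obtain ⟨w, hw⟩ := jacobiTheta₂_ne_zero (im_nat_mul hN hω)
  intro h
  have := congrFun h (((w - N * ω * (1 / 2 - j / N)) / N + 1 / 2) * π)
  rw [vartheta_eq, Pi.zero_apply, mul_eq_zero] at this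
  refine hw ?_
  convert this.resolve_left (exp_ne_zero _) using 2
  field_simp
  ring

/-- Eigenvectors of the shift by `π/N` with distinct eigenvalues. -/
theorem linearIndependent_vartheta (hN : 1 ≤ N) (hω : 0 < ω.im) :
    LinearIndependent ℂ fun j : Fin N => vartheta N ω j := by
  have hN' : (N : ℂ) ≠ 0 := by exact_mod_cast (by omega : N ≠ 0)
  let T : Module.End ℂ (ℂ → ℂ) := LinearMap.funLeft ℂ ℂ fun z => z + π / N
  refine Module.End.eigenvectors_linearIndependent' T
    (fun j : Fin N => -exp (-2 * π * I * (j : ℕ) / N)) ?_ _ fun j => ⟨?_, vartheta_ne_zero hN hω j⟩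
  · intro i j hij
    simp only [neg_inj] at hij
    have := (Complex.isPrimitiveRoot_exp N (by omega)).inv
    refine Fin.ext (this.pow_inj i.2 j.2 ?_)
    rw [← Complex.exp_neg, ← Complex.exp_nat_mul, ← Complex.exp_nat_mul]
    convert hij using 2 <;> ring
  · rw [Module.End.mem_eigenspace_iff]
    funext z
    exact vartheta_add_pi_div hN ω j z

theorem isThetaFunction_iff_mem_span (hN : 1 ≤ N) (hω : 0 < ω.im) (f : ℂ → ℂ) :
    IsThetaFunction ω N 0 f ↔
      f ∈ Submodule.span ℂ (Set.range fun j : Fin N => vartheta N ω j) := by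
  have hli := linearIndependent_vartheta hN hω
  have hle : Submodule.span ℂ (Set.range fun j : Fin N => vartheta N ω j) ≤ thetaSpace ω N :=
    Submodule.span_le.2 (by rintro _ ⟨j, rfl⟩; exact isThetaFunction_vartheta hN hω j)
  have hinj := thetaCoeff_injective ω hN
  have : Module.Finite ℂ (thetaSpace ω N) := Module.Finite.of_injective _ hinj
  have hd := LinearMap.finrank_le_finrank_of_injective hinj
  rw [Module.finrank_fin_fun] at hd
  have heq := Submodule.eq_of_le_of_finrank_le hle (by
    rwa [finrank_span_eq_card hli, Fintype.card_fin])
  rw [heq]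
  rfl

theorem finrank_thetaSpace (hN : 1 ≤ N) (hω : 0 < ω.im) :
    Module.finrank ℂ (thetaSpace ω N) = N := by
  have : Submodule.span ℂ (Set.range fun j : Fin N => vartheta N ω j) = thetaSpace ω N :=
    Submodule.ext fun f => (isThetaFunction_iff_mem_span hN hω f).symm
  rw [← this, finrank_span_eq_card (linearIndependent_vartheta hN hω), Fintype.card_fin]

end Vartheta

/-! ### Addition formula and zeros of `θ` -/

theorem theta_eq_vartheta (ω : ℂ) : theta ω = vartheta 1 ω 0 := by
  funext z
  rw [theta, vartheta, ← tsum_mul_left]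
  refine tsum_congr fun n => ?_
  have e1 : (-1 : ℂ) ^ n = exp (-n * (π * I)) := by
    rw [neg_mul, ← mul_neg, Complex.exp_int_mul, Complex.exp_neg, exp_pi_mul_I]
    norm_num
  have e2 : -I = exp (-(π / 2 * I)) := by rw [Complex.exp_neg, exp_pi_div_two_mul_I, inv_I]
  rw [e1, e2, ← Complex.exp_add, ← Complex.exp_add, ← Complex.exp_add]
  congr 1
  push_cast
  ring

variable {ω : ℂ}

theorem isThetaFunction_theta (hω : 0 < ω.im) : IsThetaFunction ω 1 0 (theta ω) :=
  theta_eq_vartheta ω ▸ isThetaFunction_vartheta le_rfl hω 0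

theorem differentiable_theta (hω : 0 < ω.im) : Differentiable ℂ (theta ω) :=
  (isThetaFunction_theta hω).1

theorem theta_ne_zero (hω : 0 < ω.im) : theta ω ≠ 0 :=
  theta_eq_vartheta ω ▸ vartheta_ne_zero le_rfl hω 0

theorem theta_neg (ω z : ℂ) : theta ω (-z) = -theta ω z := by
  rw [theta, theta, ← mul_neg, ← tsum_neg, ← ((Equiv.neg ℤ).trans (Equiv.subRight 1)).tsum_eq]
  congr 1
  refine tsum_congr fun n => ?_
  have e : (-1 : ℂ) ^ (-n - 1) = -(-1) ^ n := by
    rw [zpow_sub₀ (by norm_num), zpow_neg, ← inv_zpow]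
    norm_num [div_neg]
  simp only [Equiv.trans_apply, Equiv.neg_apply, Equiv.subRight_apply, e]
  push_cast
  ring_nf

/-- The pairs of integers, according to the parity of their sum. -/
def parityEquiv : (ℤ × ℤ) ⊕ (ℤ × ℤ) ≃ ℤ × ℤ where
  toFun := Sum.elim (fun a => (a.1 + a.2, a.1 - a.2)) (fun a => (a.1 + a.2, a.1 - a.2 - 1))
  invFun b := if (b.1 + b.2) % 2 = 0 then .inl ((b.1 + b.2) / 2, (b.1 - b.2) / 2)
    else .inr ((b.1 + b.2 + 1) / 2, (b.1 - b.2 - 1) / 2)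
  left_inv := by
    rintro (⟨a, b⟩ | ⟨a, b⟩)
    · dsimp only [Sum.elim_inl]
      rw [if_pos (by grind)]
      exact congrArg Sum.inl (Prod.ext (by grind) (by grind))
    · dsimp only [Sum.elim_inr]
      rw [if_neg (by grind)]
      exact congrArg Sum.inr (Prod.ext (by grind) (by grind))
  right_inv := by
    rintro ⟨a, b⟩
    dsimp only
    split_ifs with h
    · exact Prod.ext (by grind) (by grind)
    · exact Prod.ext (by grind) (by grind)

/-- The double series is split by the parity of the sum of its two indices; each half factors into
two series of order `2`. -/
theorem theta_add_mul_theta_sub (hω : 0 < ω.im) (x y : ℂ) :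
    theta ω (x + y) * theta ω (x - y)
      = vartheta 2 ω 0 x * vartheta 2 ω 1 y - vartheta 2 ω 1 x * vartheta 2 ω 0 y := by
  have s1 := fun z => (summable_varthetaTerm (N := 1) le_rfl hω 0 z).norm
  have s2 := fun j z => (summable_varthetaTerm (N := 2) one_le_two hω j z).norm
  have a1 := fun z => hasSum_varthetaTerm (N := 1) le_rfl hω 0 z
  have a2 := fun j z => hasSum_varthetaTerm (N := 2) one_le_two hω j z
  have p1 := (a1 (x + y)).mul (a1 (x - y)) (summable_mul_of_summable_norm (s1 _) (s1 _))
  have p2 := (a2 0 x).mul (a2 1 y) (summable_mul_of_summable_norm (s2 _ _) (s2 _ _))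
  have p3 := ((a2 1 x).mul (a2 0 y) (summable_mul_of_summable_norm (s2 _ _) (s2 _ _))).neg
  rw [theta_eq_vartheta, sub_eq_add_neg (vartheta 2 ω 0 x * _)]
  refine (parityEquiv.hasSum_iff.2 p1).unique (HasSum.sum ?_ ?_)
  · refine (congrArg (fun f : ℤ × ℤ → ℂ => HasSum f _) (funext fun a => ?_)).mpr p2
    simp only [Function.comp, parityEquiv, Equiv.coe_fn_mk, Sum.elim_inl, varthetaTerm,
      ← Complex.exp_add]
    refine Complex.exp_eq_exp_iff_exists_int.2 ⟨a.2, ?_⟩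
    push_cast
    ring
  · refine (congrArg (fun f : ℤ × ℤ → ℂ => HasSum f _) (funext fun a => ?_)).mpr p3
    simp only [Function.comp, parityEquiv, Equiv.coe_fn_mk, Sum.elim_inr, varthetaTerm,
      ← Complex.exp_add]
    rw [neg_eq_neg_one_mul, ← exp_pi_mul_I, ← Complex.exp_add]
    refine Complex.exp_eq_exp_iff_exists_int.2 ⟨a.2, ?_⟩
    push_cast
    ring

/-- Each product `θ(x+y) θ(x-y)` is a `2 × 2` minor, and the identity is the Plücker relation
between such minors. -/
theorem threeTerm_theta (hω : 0 < ω.im) : ThreeTerm (theta ω) where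
  odd := theta_neg ω
  rel x y u v := by
    rw [theta_add_mul_theta_sub hω x y, mul_assoc, theta_add_mul_theta_sub hω u v,
      theta_add_mul_theta_sub hω x u, mul_assoc, theta_add_mul_theta_sub hω y v,
      theta_add_mul_theta_sub hω x v, mul_assoc _ (theta ω (y + u)),
      theta_add_mul_theta_sub hω y u]
    ring

theorem exists_mul_ne_zero {f g : ℂ → ℂ} (hf : Differentiable ℂ f) (hg : Differentiable ℂ g)
    (hf0 : f ≠ 0) (hg0 : g ≠ 0) : ∃ w, f w * g w ≠ 0 := by
  by_contra! h
  obtain ⟨b, hb⟩ : ∃ b, g b ≠ 0 := by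
    by_contra! h'
    exact hg0 (funext h')
  have hf' : AnalyticOnNhd ℂ f Set.univ := fun z _ => hf.analyticAt z
  have h0 : AnalyticOnNhd ℂ (0 : ℂ → ℂ) Set.univ := fun z _ => analyticAt_const
  refine hf0 (hf'.eq_of_eventuallyEq h0 (z₀ := b) ?_)
  filter_upwards [hg.continuous.continuousAt.eventually_ne hb] with z hz
  exact (mul_eq_zero.1 (h z)).resolve_right hz

theorem vartheta_two_zero_add (ω y : ℂ) : vartheta 2 ω 0 (y + π * ω / 2)
    = exp (-2 * I * (y - π / 2) - I * π * ω / 2) * vartheta 2 ω 1 y := by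
  rw [vartheta, vartheta, ← tsum_mul_left, ← (Equiv.addRight (1 : ℤ)).tsum_eq (fun n : ℤ => _ * _)]
  refine tsum_congr fun n => ?_
  rw [← Complex.exp_add, Equiv.coe_addRight]
  congr 1
  push_cast
  ring

theorem vartheta_two_one_add (ω y : ℂ) : vartheta 2 ω 1 (y + π * ω / 2)
    = exp (-2 * I * (y - π / 2) - I * π * ω / 2) * vartheta 2 ω 0 y := by
  rw [vartheta, vartheta, ← tsum_mul_left]
  refine tsum_congr fun n => ?_
  rw [← Complex.exp_add]
  congr 1
  push_cast
  ring

/-- A common zero `y` would make `θ(y + w) θ(y - w)` vanish for all `w`. -/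
theorem vartheta_two_ne_zero (hω : 0 < ω.im) (y : ℂ) (h0 : vartheta 2 ω 0 y = 0) :
    vartheta 2 ω 1 y ≠ 0 := by
  intro h1
  have hd := differentiable_theta hω
  have hne : ∀ s : ℂ → ℂ, Function.Surjective s → (fun z => theta ω (s z)) ≠ 0 := by
    intro s hs h
    refine theta_ne_zero hω (funext fun z => ?_)
    obtain ⟨w, rfl⟩ := hs z
    exact congrFun h w
  obtain ⟨w, hw⟩ := exists_mul_ne_zero (f := fun w => theta ω (y + w))
    (g := fun w => theta ω (y - w)) (hd.comp (by fun_prop)) (hd.comp (by fun_prop))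
    (hne _ (add_left_surjective y)) (hne _ fun z => ⟨y - z, by ring⟩)
  refine hw ?_
  rw [theta_add_mul_theta_sub hω, h0, h1]
  ring

/-- The zeros of `θ` lie in the period lattice. -/
theorem mem_periodLattice_of_theta_eq_zero (hω : 0 < ω.im) {z₀ : ℂ} (hz : theta ω z₀ = 0) :
    z₀ ∈ periodLattice ω := by
  set A := vartheta 2 ω 0 with hA
  set B := vartheta 2 ω 1 with hB
  have hdA : Differentiable ℂ A := differentiable_vartheta one_le_two hω 0
  have hdB : Differentiable ℂ B := differentiable_vartheta one_le_two hω 1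
  have hAB : ∀ y, A (y + z₀) * B y = B (y + z₀) * A y := fun y => by
    have := theta_add_mul_theta_sub hω (y + z₀) y
    rw [add_sub_cancel_left, hz, mul_zero] at this
    linear_combination -this
  have hor : ∀ y, A y ≠ 0 ∨ B y ≠ 0 := fun y => by
    by_cases h : A y = 0
    · exact .inr (vartheta_two_ne_zero hω y h)
    · exact .inl h
  -- As `θ(z₀) = 0`, the vectors `(A, B)` at `y + z₀` and at `y` are proportional. Since `A` and `B`
  -- have no common zero, the factor `μ` is entire.
  let μ : ℂ → ℂ := fun y => if A y ≠ 0 then A (y + z₀) / A y else B (y + z₀) / B y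
  have hμA : ∀ y, μ y * A y = A (y + z₀) := fun y => by
    by_cases h : A y = 0
    · have hb := (hor y).resolve_left (not_not.2 h)
      have := hAB y
      rw [h, mul_zero] at this
      rw [h, mul_zero, (mul_eq_zero.1 this).resolve_right hb]
    · simp only [μ, if_pos h]
      field_simp
  have hμB : ∀ y, μ y * B y = B (y + z₀) := fun y => by
    by_cases h : A y = 0
    · have hb := (hor y).resolve_left (not_not.2 h)
      simp only [μ, h, ne_eq, not_true, if_false]
      field_simp
    · simp only [μ, if_pos h]
      field_simp
      rw [hAB, mul_comm]
  have huniq : ∀ y m, m * A y = A (y + z₀) → m * B y = B (y + z₀) → m = μ y := by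
    intro y m h1 h2
    rcases hor y with h | h
    · exact mul_right_cancel₀ h (h1.trans (hμA y).symm)
    · exact mul_right_cancel₀ h (h2.trans (hμB y).symm)
  have hdμ : Differentiable ℂ μ := fun y => by
    rcases hor y with h | h
    · have : DifferentiableAt ℂ (fun y => A (y + z₀) / A y) y :=
        (hdA.comp (by fun_prop : Differentiable ℂ fun y => y + z₀)).differentiableAt.div
          hdA.differentiableAt h
      refine this.congr_of_eventuallyEq ?_
      filter_upwards [hdA.continuous.continuousAt.eventually_ne h] with z hz
      rw [eq_div_iff hz, hμA]
    · have : DifferentiableAt ℂ (fun y => B (y + z₀) / B y) y :=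
        (hdB.comp (by fun_prop : Differentiable ℂ fun y => y + z₀)).differentiableAt.div
          hdB.differentiableAt h
      refine this.congr_of_eventuallyEq ?_
      filter_upwards [hdB.continuous.continuousAt.eventually_ne h] with z hz
      rw [eq_div_iff hz, hμB]
  have hp : ∀ y, μ (y + π / 2) = μ y := fun y => by
    have ha : ∀ z, A (z + π / 2) = -exp (-2 * π * I * (0 : ℕ) / 2) * A z :=
      vartheta_add_pi_div one_le_two ω 0
    have hb : ∀ z, B (z + π / 2) = -exp (-2 * π * I * (1 : ℕ) / 2) * B z :=
      vartheta_add_pi_div one_le_two ω 1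
    refine (huniq _ _ ?_ ?_).symm
    · rw [add_right_comm, ha, ha]
      linear_combination (-exp (-2 * π * I * (0 : ℕ) / 2)) * hμA y
    · rw [add_right_comm, hb, hb]
      linear_combination (-exp (-2 * π * I * (1 : ℕ) / 2)) * hμB y
  have hq : ∀ y, μ (y + π * ω / 2) = exp (-2 * I * z₀) * μ y := fun y => by
    have e : exp (-2 * I * (y + z₀ - π / 2) - I * π * ω / 2)
        = exp (-2 * I * z₀) * exp (-2 * I * (y - π / 2) - I * π * ω / 2) := by
      rw [← Complex.exp_add]
      ring_nf
    refine (huniq _ _ ?_ ?_).symm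
    · rw [add_right_comm, hA, vartheta_two_zero_add, vartheta_two_zero_add, e, ← hB]
      linear_combination (exp (-2 * I * z₀) * exp (-2 * I * (y - π / 2) - I * π * ω / 2)) * hμB y
    · rw [add_right_comm, hB, vartheta_two_one_add, vartheta_two_one_add, e, ← hA]
      linear_combination (exp (-2 * I * z₀) * exp (-2 * I * (y - π / 2) - I * π * ω / 2)) * hμA y
  -- Rescaling by `2` turns the half-periods of `μ` into `π` and `πω`; the multiplier `e^{-2iz₀}`
  -- must then be some `e^{2ikπω}`, which places `z₀` in the lattice.
  obtain ⟨k, hk⟩ := eq_exp_of_quasiperiodic (ω := ω) (h := fun z => μ (z / 2))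
    (c := exp (-2 * I * z₀)) (hdμ.comp (by fun_prop)) (fun z => by rw [add_div, hp])
    (fun z => by rw [add_div, hq]) (by
      intro h
      refine vartheta_ne_zero one_le_two hω 0 (funext fun z => ?_)
      have h1 := hμA (z - z₀)
      have h2 : μ (z - z₀) = 0 := by simpa using congrFun h (2 * (z - z₀))
      rw [h2, zero_mul, sub_add_cancel] at h1
      exact h1.symm)
  obtain ⟨m, hm⟩ := Complex.exp_eq_exp_iff_exists_int.1 hk
  refine ⟨-m, -k, ?_⟩
  push_cast
  have hI : (2 * I : ℂ) ≠ 0 := by simp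
  refine mul_left_cancel₀ hI ?_
  linear_combination -hm

/-! ### The determinant of the functions `ϑ_j` -/

/-- The product of `θ(z_i - z_j)` over the pairs `i < j`. -/
def pairProd (ω : ℂ) {N : ℕ} (z : Fin N → ℂ) : ℂ :=
  ∏ i, ∏ j ∈ Finset.Ioi i, theta ω (z i - z j)

/-- The elliptic Vandermonde product. -/
def thetaVandermonde (ω : ℂ) {N : ℕ} (z : Fin N → ℂ) : ℂ := theta ω (∑ i, z i) * pairProd ω z

/-- The determinant of the matrix with entries `ϑ_j(z_i)`. -/
def thetaDet (ω : ℂ) {N : ℕ} (z : Fin N → ℂ) : ℂ :=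
  (Matrix.of fun i j : Fin N => vartheta N ω j (z i)).det

section Determinant

variable {ω : ℂ} {n : ℕ}

theorem pairProd_eq_zero {N : ℕ} {z : Fin N → ℂ} {a b : Fin N} (hab : a ≠ b) (h : z a = z b) :
    pairProd ω z = 0 := by
  have h0 : theta ω 0 = 0 := by
    have := theta_neg ω 0
    rw [neg_zero] at this
    linear_combination this / 2
  have key : ∀ a b : Fin N, a < b → z a = z b → pairProd ω z = 0 := fun a b hab h =>
    Finset.prod_eq_zero (Finset.mem_univ a)
      (Finset.prod_eq_zero (Finset.mem_Ioi.2 hab) (by rw [h, sub_self, h0]))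
  rcases lt_or_gt_of_ne hab with hlt | hlt
  · exact key a b hlt h
  · exact key b a hlt h.symm

theorem theta_add_pi (hω : 0 < ω.im) (z : ℂ) : theta ω (z + π) = -theta ω z := by
  rw [(isThetaFunction_theta hω).2.1]
  ring

theorem theta_add_pi_mul (hω : 0 < ω.im) (z : ℂ) :
    theta ω (z + π * ω) = -exp (-I * (2 * z + π * ω)) * theta ω z := by
  rw [(isThetaFunction_theta hω).2.2]
  simp

theorem isThetaFunction_prod (hω : 0 < ω.im) (y : Fin n → ℂ) :
    IsThetaFunction ω (n + 1) 0 fun w => theta ω (w + ∑ j, y j) * ∏ j, theta ω (w - y j) := by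
  have hd := differentiable_theta hω
  refine ⟨?_, fun w => ?_, fun w => ?_⟩
  · exact (hd.comp (by fun_prop)).mul (Differentiable.fun_finsetProd fun j _ =>
      hd.comp (by fun_prop))
  · beta_reduce
    rw [add_right_comm w, theta_add_pi hω]
    simp only [add_sub_right_comm w, theta_add_pi hω, Finset.prod_neg, Finset.card_univ,
      Fintype.card_fin]
    ring
  · beta_reduce
    rw [add_right_comm w, theta_add_pi_mul hω]
    simp only [add_sub_right_comm w, theta_add_pi_mul hω, neg_mul,
      Finset.prod_neg, Finset.card_univ, Fintype.card_fin, Finset.prod_mul_distrib,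
      ← Complex.exp_sum, mul_zero, Complex.exp_zero]
    have e : exp (-(I * (2 * (w + ∑ j, y j) + π * ω))) * exp (∑ j, -(I * (2 * (w - y j) + π * ω)))
        = exp (-(I * ((n + 1 : ℕ) : ℂ) * (2 * w + π * ω))) := by
      rw [← Complex.exp_add]
      congr 1
      simp only [Finset.sum_neg_distrib, ← Finset.mul_sum, Finset.sum_add_distrib,
        Finset.sum_sub_distrib, Finset.sum_const, Finset.card_univ, Fintype.card_fin, nsmul_eq_mul]
      push_cast
      ring
    rw [← e]
    ring

/-- A transposition brings the variable `z_i` to the first place, at the cost of a sign. -/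
theorem thetaVandermonde_update (ω : ℂ) (z : Fin (n + 1) → ℂ) (i : Fin (n + 1)) :
    ∃ (s : ℂ) (y : Fin n → ℂ), ∀ w, thetaVandermonde ω (Function.update z i w)
      = s * (theta ω (w + ∑ j, y j) * ∏ j, theta ω (w - y j)) := by
  set σ := Equiv.swap 0 i
  set y : Fin n → ℂ := fun k => z (σ k.succ)
  refine ⟨(Equiv.Perm.sign σ : ℤ) * pairProd ω y, y, fun w => ?_⟩
  set u := Function.update z i w
  have hu0 : u (σ 0) = w := by simp [u, σ]
  have hus : ∀ k : Fin n, u (σ k.succ) = y k := fun k => by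
    refine Function.update_of_ne (fun h => Fin.succ_ne_zero k ?_) _ _
    exact σ.injective (by rw [h]; simp [σ])
  have hsum : ∑ k, u k = w + ∑ j, y j := by
    rw [← Equiv.sum_comp σ u, Fin.sum_univ_succ, hu0]
    simp only [hus]
  have hs : ((Equiv.Perm.sign σ : ℤ) : ℂ) * (Equiv.Perm.sign σ : ℤ) = 1 := by
    rw [← Int.cast_mul, ← Units.val_mul, Int.units_mul_self]
    simp
  have hp := Equiv.Perm.prod_Ioi_comp_eq_sign_mul_prod σ (f := fun a b => theta ω (u a - u b))
    fun a b => by rw [← theta_neg, neg_sub]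
  rw [Fin.prod_univ_succ] at hp
  simp only [Fin.prod_Ioi_zero, Fin.prod_Ioi_succ, hu0, hus] at hp
  rw [thetaVandermonde, hsum, pairProd, pairProd]
  linear_combination theta ω (w + ∑ j, y j) * (-(Equiv.Perm.sign σ : ℤ) * hp
    - (∏ i, ∏ j ∈ Finset.Ioi i, theta ω (u i - u j)) * hs)

theorem isThetaFunction_thetaVandermonde (hω : 0 < ω.im) (z : Fin (n + 1) → ℂ)
    (i : Fin (n + 1)) :
    IsThetaFunction ω (n + 1) 0 fun w => thetaVandermonde ω (Function.update z i w) := by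
  obtain ⟨s, y, h⟩ := thetaVandermonde_update ω z i
  rw [funext h]
  exact (thetaSpace ω (n + 1)).smul_mem s (isThetaFunction_prod hω y)

theorem thetaVandermonde_update_eq_zero (z : Fin (n + 1) → ℂ) {i j : Fin (n + 1)} (hij : j ≠ i) :
    thetaVandermonde ω (Function.update z i (z j)) = 0 := by
  rw [thetaVandermonde, pairProd_eq_zero hij (by simp [hij]), mul_zero]

/-- Evaluation of theta functions at given points. -/
def thetaEval (ω : ℂ) {N : ℕ} (z : Fin N → ℂ) : thetaSpace ω N →ₗ[ℂ] (Fin N → ℂ) where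
  toFun f i := f.1 (z i)
  map_add' _ _ := rfl
  map_smul' _ _ := rfl

/-- Lagrange interpolation: replacing `z_i` by a variable in the Vandermonde product gives a theta
function that vanishes at the other nodes but not at `z_i`. Evaluation is thus surjective, hence
injective by dimension. -/
theorem thetaEval_injective (hω : 0 < ω.im) {z : Fin (n + 1) → ℂ}
    (hz : thetaVandermonde ω z ≠ 0) : Function.Injective (thetaEval ω z) := by
  have hfr : Module.finrank ℂ (thetaSpace ω (n + 1)) = Module.finrank ℂ (Fin (n + 1) → ℂ) := by
    rw [finrank_thetaSpace (by omega) hω, Module.finrank_fin_fun]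
  have : Module.Finite ℂ (thetaSpace ω (n + 1)) :=
    Module.Finite.of_injective _ (thetaCoeff_injective ω (by omega))
  refine (LinearMap.injective_iff_surjective_of_finrank_eq_finrank hfr).2 fun v => ?_
  let G : Fin (n + 1) → thetaSpace ω (n + 1) := fun i =>
    ⟨_, isThetaFunction_thetaVandermonde hω z i⟩
  have hG : ∀ i, thetaEval ω z (G i) = Pi.single i (thetaVandermonde ω z) := fun i => by
    funext j
    change thetaVandermonde ω (Function.update z i (z j)) = _
    by_cases h : j = i
    · subst h
      simp
    · rw [thetaVandermonde_update_eq_zero z h, Pi.single_eq_of_ne h]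
  refine ⟨∑ i, (v i / thetaVandermonde ω z) • G i, ?_⟩
  rw [map_sum]
  funext j
  simp only [map_smul, hG, Finset.sum_apply, Pi.smul_apply, smul_eq_mul, Pi.single_apply, mul_ite,
    mul_zero, Finset.sum_ite_eq, Finset.mem_univ, if_true]
  field_simp

theorem eq_zero_of_thetaEval (hω : 0 < ω.im) {z : Fin (n + 1) → ℂ}
    (hz : thetaVandermonde ω z ≠ 0) {f : ℂ → ℂ} (hf : f ∈ thetaSpace ω (n + 1))
    (h0 : ∀ i, f (z i) = 0) : f = 0 :=
  congrArg Subtype.val ((injective_iff_map_eq_zero _).1 (thetaEval_injective hω hz) ⟨f, hf⟩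
    (funext h0))

theorem thetaDet_ne_zero (hω : 0 < ω.im) {z : Fin (n + 1) → ℂ}
    (hz : thetaVandermonde ω z ≠ 0) : thetaDet ω z ≠ 0 := by
  intro h
  obtain ⟨v, hv, hmv⟩ := Matrix.exists_mulVec_eq_zero_iff.2 h
  refine hv (funext fun j => ?_)
  refine Fintype.linearIndependent_iff.1
    (linearIndependent_vartheta (N := n + 1) (by omega) hω) v ?_ j
  refine eq_zero_of_thetaEval hω hz (Submodule.sum_mem _ fun j _ => Submodule.smul_mem _ _
    (isThetaFunction_vartheta (by omega) hω _)) fun i => ?_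
  have := congrFun hmv i
  simp only [Matrix.mulVec, dotProduct, Matrix.of_apply, Pi.zero_apply] at this
  simpa [mul_comm] using this

theorem thetaDet_update_mem (hω : 0 < ω.im) (z : Fin (n + 1) → ℂ) (i : Fin (n + 1)) :
    (fun w => thetaDet ω (Function.update z i w)) ∈ thetaSpace ω (n + 1) := by
  set M := Matrix.of fun i j : Fin (n + 1) => vartheta (n + 1) ω j (z i)
  have : (fun w => thetaDet ω (Function.update z i w))
      = ∑ j : Fin (n + 1), (Matrix.cramer M.transpose (fun k => if j = k then 1 else 0) i) •
        vartheta (n + 1) ω j := by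
    funext w
    have h := Matrix.cramer_transpose_apply M (fun j : Fin (n + 1) => vartheta (n + 1) ω j w) i
    rw [LinearMap.pi_apply_eq_sum_univ (Matrix.cramer M.transpose)] at h
    have e : thetaDet ω (Function.update z i w)
        = (M.updateRow i fun j : Fin (n + 1) => vartheta (n + 1) ω j w).det := by
      unfold thetaDet
      congr 1
      ext a b
      by_cases ha : a = i
      · subst ha
        simp
      · simp [ha, M]
    rw [e, ← h]
    simp [mul_comm]
  rw [this]
  exact Submodule.sum_mem _ fun j _ => Submodule.smul_mem _ _
    (isThetaFunction_vartheta (by omega) hω _)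

/-- As functions of `w`, both sides lie in the space of theta functions and agree at all `N` nodes:
they vanish at `z_j` for `j ≠ i`. -/
theorem thetaDet_update (hω : 0 < ω.im) {z : Fin (n + 1) → ℂ}
    (hz : thetaVandermonde ω z ≠ 0) (i : Fin (n + 1)) (w : ℂ) :
    thetaDet ω (Function.update z i w) * thetaVandermonde ω z
      = thetaDet ω z * thetaVandermonde ω (Function.update z i w) := by
  have := eq_zero_of_thetaEval hω hz (f := thetaVandermonde ω z •
      (fun w => thetaDet ω (Function.update z i w)) - thetaDet ω z •
      fun w => thetaVandermonde ω (Function.update z i w))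
    (Submodule.sub_mem _ (Submodule.smul_mem _ _ (thetaDet_update_mem hω z i))
      (Submodule.smul_mem _ _ (isThetaFunction_thetaVandermonde hω z i))) fun j => by
    by_cases h : j = i
    · subst h
      simp [mul_comm]
    · have h0 : thetaDet ω (Function.update z i (z j)) = 0 :=
        Matrix.det_zero_of_row_eq (i := i) (j := j) (Ne.symm h) (by funext k; simp [h])
      simp [thetaVandermonde_update_eq_zero z h, h0]
  have := congrFun this w
  simp only [Pi.sub_apply, Pi.smul_apply, smul_eq_mul, Pi.zero_apply] at this
  linear_combination this

/-- The determinant of the `ϑ_j` is a constant multiple of the elliptic Vandermonde product. -/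
theorem thetaDet_mul_thetaVandermonde (hω : 0 < ω.im) {z z' : Fin (n + 1) → ℂ}
    (hz : thetaVandermonde ω z ≠ 0) (hz' : thetaVandermonde ω z' ≠ 0) :
    thetaDet ω z * thetaVandermonde ω z' = thetaDet ω z' * thetaVandermonde ω z := by
  -- The coordinates are changed one at a time; `S` contains those in which `z` and `z'` may differ.
  suffices H : ∀ (S : Finset (Fin (n + 1))) (z z' : Fin (n + 1) → ℂ), (∀ i ∉ S, z i = z' i) →
      thetaVandermonde ω z ≠ 0 → thetaVandermonde ω z' ≠ 0 →
      thetaDet ω z * thetaVandermonde ω z' = thetaDet ω z' * thetaVandermonde ω z from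
    H Finset.univ z z' (fun i hi => absurd (Finset.mem_univ i) hi) hz hz'
  clear hz hz'
  intro S
  induction S using Finset.induction_on with
  | empty =>
    intro z z' h _ _
    rw [show z = z' from funext fun i => h i (by simp)]
  | insert i S hi ih =>
    intro z z' h hz hz'
    have hne : ∀ x : Fin (n + 1) → ℂ, thetaVandermonde ω x ≠ 0 →
        (fun w => thetaVandermonde ω (Function.update x i w)) ≠ 0 := fun x hx h => hx (by
      simpa using congrFun h (x i))
    -- A common new value of the `i`-th coordinate that keeps both Vandermonde products nonzero.
    obtain ⟨w, hw⟩ := exists_mul_ne_zero (isThetaFunction_thetaVandermonde hω z i).1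
      (isThetaFunction_thetaVandermonde hω z' i).1 (hne z hz) (hne z' hz')
    have h1 := thetaDet_update hω hz i w
    have h2 := thetaDet_update hω hz' i w
    have h3 := ih (Function.update z i w) (Function.update z' i w) (fun k hk => by
      by_cases hki : k = i
      · subst hki
        simp
      · simp only [Function.update_of_ne hki]
        exact h k (by simp [hki, hk])) (left_ne_zero_of_mul hw) (right_ne_zero_of_mul hw)
    refine mul_right_cancel₀ hw ?_
    linear_combination (-thetaVandermonde ω z' * thetaVandermonde ω (Function.update z' i w)) * h1
      + thetaVandermonde ω z * thetaVandermonde ω z' * h3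
      + (thetaVandermonde ω z * thetaVandermonde ω (Function.update z i w)) * h2

end Determinant

/-! ### The matrices `Θ^{(r, h)}` -/

namespace Params

variable {n : ℕ} (p : Params (n + 1))

theorem det_Theta (r : ℤ) (h : Spins (n + 1)) :
    (p.Theta r h).det = thetaDet p.ω fun i => p.xiShift h i - p.xiBar r := rfl

/-- The centre `ξ̄_r` is chosen so that the shifted points sum to `-t_{r,h}`. -/
theorem thetaVandermonde_xi (r : ℤ) (h : Spins (n + 1)) :
    thetaVandermonde p.ω (fun i => p.xiShift h i - p.xiBar r)
      = -theta p.ω (p.trh r h) * pairProd p.ω (p.xiShift h) := by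
  have e : ∑ i, (p.xiShift h i - p.xiBar r) = -p.trh r h := by
    rw [← trh_add]
    simp only [xiShift, xiBar, Finset.sum_sub_distrib, ← Finset.mul_sum, Finset.sum_const,
      Finset.card_univ, Fintype.card_fin, nsmul_eq_mul]
    have : ((n + 1 : ℕ) : ℂ) ≠ 0 := Nat.cast_ne_zero.2 (by omega)
    rw [mul_div_cancel₀ _ this]
    push_cast
    ring
  simp only [thetaVandermonde, pairProd, e, theta_neg, sub_sub_sub_cancel_right]

theorem pairRatio_eq (h : Spins (n + 1)) :
    pairRatio (theta p.ω) p.η p.ξ h = pairProd p.ω p.ξ / pairProd p.ω (p.xiShift h) := by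
  simp only [pairRatio, pairProd, Finset.prod_div_distrib, xiShift]

theorem pairProd_xiShift_ne_zero (hg : Generic (theta p.ω) p.η p.ξ) (h : Spins (n + 1)) :
    pairProd p.ω (p.xiShift h) ≠ 0 := by
  refine Finset.prod_ne_zero_iff.2 fun a _ => Finset.prod_ne_zero_iff.2 fun b hb => ?_
  have hab : a ≠ b := (Finset.mem_Ioi.1 hb).ne
  have h01 : ∀ x : Fin 2, x = 0 ∨ x = 1 := by decide
  unfold xiShift
  rcases h01 (h a) with ha | ha <;> rcases h01 (h b) with hb | hb <;> rw [ha, hb]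
  · simpa using hg.zero a b hab
  · have := hg.add a b hab
    rw [show p.ξ a - p.ξ b + p.η = p.ξ a - (p.ξ b - p.η) by ring] at this
    simpa using this
  · have := hg.sub a b hab
    rw [sub_right_comm] at this
    simpa using this
  · simpa using hg.zero a b hab

end Params

end SOS

end

/-! ### The normalization constant and the final formula -/

theorem mainTheorem9 {N : ℕ} (hN : 1 ≤ N) (p : SOS.Params N)
    (hω : 0 < p.ω.im)
    (hx : p.x = 0 ∨ p.x = 1) (hy : p.y = 0 ∨ p.y = 1)
    (hη : p.η ∉ SOS.periodLattice p.ω)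
    (ht : ∀ a : ℤ, p.t a ∉ SOS.periodLattice p.ω)
    (hξ : ∀ ε ∈ ({-1, 0, 1} : Set ℤ), ∀ a b : Fin N, a ≠ b →
      p.ξ a - p.ξ b + ε * p.η ∉ SOS.periodLattice p.ω) :
    (LinearIndependent ℂ (fun j : Fin N => SOS.vartheta N p.ω j) ∧
      ∀ f : ℂ → ℂ, SOS.IsThetaFunction p.ω N 0 f ↔
        f ∈ Submodule.span ℂ (Set.range fun j : Fin N => SOS.vartheta N p.ω j)) ∧
    SOS.theta p.ω (p.trh 0 1) ≠ 0 ∧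
    (∀ (r : ℤ) (h : SOS.Spins N), (p.Theta r h).det ≠ 0) ∧
    ∃ c : ℂ, c ≠ 0 ∧ ∀ (r r' : ℤ) (h h' : SOS.Spins N),
      p.sovBra c r h (p.sovKet c r' h') =
        if r = r' ∧ h = h' then
          SOS.theta p.ω (p.trh r 1) / SOS.theta p.ω (p.trh 0 1) *
            (Complex.exp (-Complex.I * p.y * p.η * ∑ k, ((h k : ℕ) : ℂ)) /
              (p.Theta r h).det)
        else 0 := by
  obtain ⟨n, rfl⟩ : ∃ n, N = n + 1 := ⟨N - 1, by omega⟩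
  have hz : ∀ {z}, z ∉ SOS.periodLattice p.ω → SOS.theta p.ω z ≠ 0 := fun hz h0 =>
    hz (SOS.mem_periodLattice_of_theta_eq_zero hω h0)
  have hta : ∀ a, SOS.theta p.ω (p.t a) ≠ 0 := fun a => hz (ht a)
  have htr : ∀ r h, SOS.theta p.ω (p.trh r h) ≠ 0 := fun r h => by
    rw [← p.t_dynLabel]
    exact hta _
  have hg : SOS.Generic (SOS.theta p.ω) p.η p.ξ :=
    { eta := hz hη
      zero := fun a b hab => hz (by simpa using hξ 0 (by simp) a b hab)
      add := fun a b hab => hz (by simpa using hξ 1 (by simp) a b hab)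
      sub := fun a b hab => hz (by simpa [sub_eq_add_neg] using hξ (-1) (by simp) a b hab) }
  have hV : ∀ r h, SOS.thetaVandermonde p.ω (fun i => p.xiShift h i - p.xiBar r) ≠ 0 :=
    fun r h => by
      rw [p.thetaVandermonde_xi]
      exact mul_ne_zero (neg_ne_zero.2 (htr r h)) (p.pairProd_xiShift_ne_zero hg h)
  have hD : ∀ (r : ℤ) (h : SOS.Spins (n + 1)), (p.Theta r h).det ≠ 0 := fun r h => by
    rw [p.det_Theta]
    exact SOS.thetaDet_ne_zero hω (hV r h)
  refine ⟨⟨SOS.linearIndependent_vartheta hN hω, SOS.isThetaFunction_iff_mem_span hN hω⟩,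
    htr 0 1, hD, ?_⟩
  -- `K` is the ratio of determinant to Vandermonde product at `r = 0`, `h = 0`; it is the same for
  -- all `r` and `h`.
  obtain ⟨K, hK0, hK⟩ : ∃ K : ℂ, K ≠ 0 ∧ ∀ r h, (p.Theta r h).det
      = K * (-SOS.theta p.ω (p.trh r h) * SOS.pairProd p.ω (p.xiShift h)) := by
    refine ⟨(p.Theta 0 0).det / SOS.thetaVandermonde p.ω (fun i => p.xiShift 0 i - p.xiBar 0),
      div_ne_zero (hD 0 0) (hV 0 0), fun r h => ?_⟩
    rw [← p.thetaVandermonde_xi, div_mul_eq_mul_div, eq_div_iff (hV 0 0), p.det_Theta,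
      p.det_Theta]
    exact SOS.thetaDet_mul_thetaVandermonde hω (hV r h) (hV 0 0)
  have hP0 : SOS.pairProd p.ω p.ξ ≠ 0 := by
    have : p.xiShift (0 : SOS.Spins (n + 1)) = p.ξ := by
      funext i
      simp [SOS.Params.xiShift]
    rw [← this]
    exact p.pairProd_xiShift_ne_zero hg 0
  -- `C` gathers the factors of the pairing independent of `r` and `h`; the leading minus sign comes
  -- from `θ(-t_{r,h}) = -θ(t_{r,h})`. The normalization enters both states, so `c` is a square root
  -- of `C`.
  set C : ℂ := -(-1) ^ (n + 1) * K * Complex.exp (p.kappa * ((n + 1 : ℕ) * p.η))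
    * SOS.pairProd p.ω p.ξ * SOS.theta p.ω (p.trh 0 1) with hC
  have hC0 : C ≠ 0 := by
    refine mul_ne_zero (mul_ne_zero (mul_ne_zero (mul_ne_zero ?_ hK0) (Complex.exp_ne_zero _))
      hP0) (htr 0 1)
    exact neg_ne_zero.2 (pow_ne_zero _ (by norm_num))
  obtain ⟨c, hc⟩ := IsAlgClosed.exists_pow_nat_eq C (n := 2) (by norm_num)
  have hc0 : c ≠ 0 := by
    rintro rfl
    exact hC0 (by rw [← hc]; norm_num)
  refine ⟨c, hc0, fun r r' h h' => ?_⟩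
  rw [p.sov_pairing (SOS.theta_neg p.ω) (SOS.threeTerm_theta hω) hg hta]
  refine if_congr Iff.rfl ?_ rfl
  have ht1 := htr r 1
  have ht2 := htr r h
  have ht3 := htr 0 1
  have hPh := p.pairProd_xiShift_ne_zero hg h
  have hr : SOS.twist (SOS.theta p.ω) p.kappa (p.trh r 1)
      / SOS.twist (SOS.theta p.ω) p.kappa (p.trh r h)
      = Complex.exp (p.kappa * ((n + 1 : ℕ) * p.η))
        * Complex.exp (-Complex.I * p.y * p.η * ∑ k, ((h k : ℕ) : ℂ))
        * (SOS.theta p.ω (p.trh r 1) / SOS.theta p.ω (p.trh r h)) := by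
    have e : Complex.exp (p.kappa * p.trh r 1) = Complex.exp (p.kappa * ((n + 1 : ℕ) * p.η))
        * Complex.exp (-Complex.I * p.y * p.η * ∑ k, ((h k : ℕ) : ℂ))
        * Complex.exp (p.kappa * p.trh r h) := by
      rw [← Complex.exp_add, ← Complex.exp_add, ← p.trh_one, ← p.trh_add r h]
      congr 1
      simp only [SOS.Params.kappa]
      push_cast
      ring
    rw [SOS.twist, SOS.twist, e]
    have := Complex.exp_ne_zero (p.kappa * p.trh r h)
    field_simp
  rw [hr, p.pairRatio_eq, hK, inv_pow, hc, hC]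
  have he := Complex.exp_ne_zero (p.kappa * ((n + 1 : ℕ) * p.η))
  have hs : ((-1 : ℂ) ^ (n + 1)) ≠ 0 := pow_ne_zero _ (by norm_num)
  field_simp
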